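/- **Setting.** A two-dimensional conformal field theory (NS sector) consists of a complex vector space $H$ of finite-energy states, identified with the local operators, with a vacuum $|0\rangle$, a fermion parity $(-1)^F$, a Hermitian inner product $\langle\cdot|\cdot\rangle$, and operator product coefficients $$a(z,\bar z)\,b(0)=\sum_{r,s\in\mathbb R} z^{r}\bar z^{s}\,(a_{[r,s]}b),\qquad a_{[r,s]}b\neq0\Rightarrow r-s\in\mathbb Z .$$ There are a holomorphic field $T(z)=\sum_n L_nz^{-n-2}$ and an antiholomorphic field $\tilde T(\bar z)=\sum_n\tilde L_n\bar z^{-n-2}$ whose modes generate commuting Virasoro algebras of central charges $c,\tilde c$. The space $H$ is spanned by the simultaneous eigenspaces of $(L_0,\tilde L_0)$ with real weights $(h,\tilde h)$; the energies $h+\tilde h$ are bounded below; eigenspaces of different weights are orthogonal; $a_{[r,s]}b$ has weights $(h_a+h_b+r,\tilde h_a+\tilde h_b+s)$. The usual vacuum axioms hold, and $L_{-1},\tilde L_{-1}$ act on operators as $\partial,\bar\partial$. Finally, for all $v,a,b,d$ with $a,b$ of definite parity there is a single-valued real-analytic correlation function $\langle v|a(z)b(w)|d\rangle$ on $\{z,w\ne0,\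 z\neq w\}$, given by the absolutely convergent expansions of $a(z)\,(b(w)d)$ for $|z|>|w|>0$, of $\pm b(w)\,(a(z)d)$ for $|w|>|z|>0$ (with sign $-$ when $a,b$ are both odd), and of $(a(z-w)b)(w)\,d$ for $|w|>|z-w|>0$. The theory is *$N=2$ superconformal* if there are moreover holomorphic fields $J(z)=\sum_n J_nz^{-n-1}$ (even) and $G^\pm(z)=\sum_{r\in\mathbb Z+1/2}G^\pm_rz^{-r-3/2}$ (odd), of weights $(1,0)$ and $(\tfrac32,0)$, with $$\{G^+_r,G^-_s\}=2L_{r+s}+(r-s)J_{r+s}+\tfrac c{12}(4r^2-1)\delta_{r,-s},\quad \{G^\pm_r,G^\pm_s\}=0,\quad [L_m,G^\pm_r]=(\tfrac m2-r)G^\pm_{m+r},$$ $$[L_m,J_n]=-nJ_{m+n},\qquad [J_m,G^\pm_r]=\pm G^\pm_{m+r},\qquad [J_m,J_n]=\tfrac c3m\,\delta_{m,-n}.$$ It is *unitary* if the inner product is positive definite and $L_n^\dagger=L_{-n}$, $\tilde L_n^\dagger=\tilde L_{-n}$, $J_n^\dagger=J_{-n}$, $(G^\pm_r)^\dagger=G^\mp_{-r}$.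 It is *non-degenerate* if the spectrum of $L_0+\tilde L_0$ is discrete (eigenvalues do not accumulate and have finite multiplicity). A *chiral primary* of weight $h$ and charge $q$ is a state $v$ with $L_0v=hv$, $J_0v=qv$, $L_nv=J_nv=G^\pm_rv=0$ for all $n,r>0$, and $G^+_{-1/2}v=0$. Let $\mathcal R_c$ be the span of the holomorphic chiral primaries $\mathcal O(z)$. **Theorem.** In a unitary $N=2$ superconformal theory: 1. Let $a,b$ be chiral primaries of weights and charges $(h_1,q_1)$, $(h_2,q_2)$, possibly depending on $\bar z$ as well. Only powers $z^r$ with $r\ge0$ occur in $a(z,\bar z)b(0)$, and every coefficient $a_{[0,s]}b$, which is what survives at $z^0$, is a chiral primary (possibly zero) of weight $h_1+h_2$ and charge $q_1+q_2$. 2. Every nonzero chiral primary satisfies $0\le h\le c/6$. 3. The operator products of elements of $\mathcal R_c$ are non-singular, and $\mathcal R_c$ is an associative ring (a $\mathbb C$-algebra) with unit $|0\rangle$ under the operator product at the same point $a\cdot b=\lim_{z\to0}a(z)b(0)$, the limit being taken in matrix elements. 4. If the theory is non-degenerate, then $\mathcal R_c$ is finite, that is, finite-dimensional over $\mathbb C$.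 If the antiholomorphic sector carries a unitary $N=2$ algebra as well (with central charge $\tilde c$ and antiholomorphic currents), then 3 and 4 hold also for the span $\mathcal R_{cc}$ of the operators $\mathcal O(z,\bar z)$ that are chiral primaries of both sectors, with $a\cdot b=\lim_{z\to0}a(z,\bar z)b(0)$. -/

import Mathlib

open Filter Topology

noncomputable section

/-- The single-valued function `z^r * conj(z)^s` on the punctured plane, for `r - s` an integer,
written in polar form. -/
def zPow (r s : ℝ) (z : ℂ) : ℂ :=
  ((‖z‖ ^ (r + s) : ℝ) : ℂ) * Complex.exp (Complex.I * ((r - s : ℝ) : ℂ) * (z.arg : ℂ))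

/-- Elements of `ℤ + 1/2`, the mode numbers of the supercurrents in the NS sector. -/
def IsHalfOdd (r : ℝ) : Prop := ∃ k : ℤ, r = k + 1 / 2

/-- The Virasoro algebra with central charge `c`, for mode operators `L n`, `n ∈ ℤ`. -/
def IsVirasoro {H : Type*} [AddCommGroup H] [Module ℂ H] (c : ℝ)
    (L : ℝ → Module.End ℂ H) : Prop :=
  ∀ m n : ℤ, L m * L n - L n * L m =
    ((m : ℂ) - n) • L (m + n) +
      (if m + n = 0 then (c : ℂ) / 12 * m * ((m : ℂ) ^ 2 - 1) else 0) • (1 : Module.End ℂ H)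

/-- Mode operators of `T, J, G⁺, G⁻` (or of their antiholomorphic partners). -/
structure N2Modes (H : Type*) [AddCommGroup H] [Module ℂ H] where
  L : ℝ → Module.End ℂ H
  J : ℝ → Module.End ℂ H
  Gp : ℝ → Module.End ℂ H
  Gm : ℝ → Module.End ℂ H

namespace N2Modes

variable {H : Type*} [AddCommGroup H] [Module ℂ H]

/-- The `N = 2` super-Virasoro algebra (NS sector) with central charge `c`. -/
structure IsSuperVirasoro (A : N2Modes H) (c : ℝ) : Prop where
  LL : IsVirasoro c A.L
  LG : ∀ (m : ℤ) (r : ℝ), IsHalfOdd r →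
    A.L m * A.Gp r - A.Gp r * A.L m = ((m : ℂ) / 2 - r) • A.Gp (m + r) ∧
    A.L m * A.Gm r - A.Gm r * A.L m = ((m : ℂ) / 2 - r) • A.Gm (m + r)
  GpGm : ∀ r s : ℝ, IsHalfOdd r → IsHalfOdd s →
    A.Gp r * A.Gm s + A.Gm s * A.Gp r =
      (2 : ℂ) • A.L (r + s) + ((r : ℂ) - s) • A.J (r + s) +
        (if r + s = 0 then (c : ℂ) / 12 * (4 * (r : ℂ) ^ 2 - 1) else 0) • (1 : Module.End ℂ H)
  GG : ∀ r s : ℝ, IsHalfOdd r → IsHalfOdd s →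
    A.Gp r * A.Gp s + A.Gp s * A.Gp r = 0 ∧ A.Gm r * A.Gm s + A.Gm s * A.Gm r = 0
  LJ : ∀ m n : ℤ, A.L m * A.J n - A.J n * A.L m = (-(n : ℂ)) • A.J (m + n)
  JG : ∀ (m : ℤ) (r : ℝ), IsHalfOdd r →
    A.J m * A.Gp r - A.Gp r * A.J m = A.Gp (m + r) ∧
    A.J m * A.Gm r - A.Gm r * A.J m = -A.Gm (m + r)
  JJ : ∀ m n : ℤ, A.J m * A.J n - A.J n * A.J m =
    (if m + n = 0 then (c : ℂ) / 3 * m else 0) • (1 : Module.End ℂ H)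

/-- `L_n† = L_{-n}`, `J_n† = J_{-n}`, `(G^±_r)† = G^∓_{-r}` with respect to an inner product. -/
structure IsStar (A : N2Modes H) (form : H →ₗ⋆[ℂ] H →ₗ[ℂ] ℂ) : Prop where
  L_adj : ∀ (n : ℤ) (v w : H), form (A.L n v) w = form v (A.L (-n) w)
  J_adj : ∀ (n : ℤ) (v w : H), form (A.J n v) w = form v (A.J (-n) w)
  Gp_adj : ∀ (r : ℝ) (v w : H), IsHalfOdd r → form (A.Gp r v) w = form v (A.Gm (-r) w)
  Gm_adj : ∀ (r : ℝ) (v w : H), IsHalfOdd r → form (A.Gm r v) w = form v (A.Gp (-r) w)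

/-- `v` is an `N = 2` primary of weight `h` and charge `q`. -/
structure IsPrimary (A : N2Modes H) (h q : ℝ) (v : H) : Prop where
  weight : A.L 0 v = (h : ℂ) • v
  charge : A.J 0 v = (q : ℂ) • v
  L_pos : ∀ n : ℤ, 0 < n → A.L n v = 0
  J_pos : ∀ n : ℤ, 0 < n → A.J n v = 0
  Gp_pos : ∀ r : ℝ, IsHalfOdd r → 0 < r → A.Gp r v = 0
  Gm_pos : ∀ r : ℝ, IsHalfOdd r → 0 < r → A.Gm r v = 0

/-- `v` is chiral: `G⁺_{-1/2} v = 0`. -/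
def IsChiral (A : N2Modes H) (v : H) : Prop := A.Gp (-1 / 2) v = 0

/-- `v` is a chiral primary of weight `h` and charge `q`. -/
def IsChiralPrimary (A : N2Modes H) (h q : ℝ) (v : H) : Prop :=
  A.IsPrimary h q v ∧ A.IsChiral v

end N2Modes

/-- The data of a two-dimensional field theory on the plane in radial quantization.  `H` is the
space of states of finite energy, identified with the space of local operators by the
state-operator correspondence.  The local operator of `a` acts by
`a(z, z̄) b = ∑_{r,s} z^r z̄^s (ope r s a b)`. -/
structure CFTData (H : Type*) [AddCommGroup H] [Module ℂ H] where
  /-- the vacuum state, corresponding to the unit operator -/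
  vac : H
  /-- the fermion parity `(-1)^F` -/
  fermion : H →ₗ[ℂ] H
  /-- the coefficients of the operator product expansion -/
  ope : ℝ → ℝ → H →ₗ[ℂ] H →ₗ[ℂ] H
  /-- the inner product `⟨v | w⟩`, conjugate linear in `v` -/
  form : H →ₗ⋆[ℂ] H →ₗ[ℂ] ℂ
  /-- the state of the holomorphic energy-momentum tensor `T(z)` -/
  T : H
  /-- the state of the antiholomorphic energy-momentum tensor -/
  Tbar : H
  /-- the central charge of the holomorphic sector -/
  c : ℝ
  /-- the central charge of the antiholomorphic sector -/
  cbar : ℝ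

/-- The states of the fields `J, G⁺, G⁻`. -/
structure N2Currents (H : Type*) where
  j : H
  gp : H
  gm : H

namespace CFTData

variable {H : Type*} [AddCommGroup H] [Module ℂ H]

/-- The local operator `a(z, z̄)` depends on `z` only. -/
def IsHolomorphic (X : CFTData H) (a : H) : Prop := ∀ r s : ℝ, s ≠ 0 → X.ope r s a = 0

/-- The local operator `a(z, z̄)` depends on `z̄` only. -/
def IsAntiholomorphic (X : CFTData H) (a : H) : Prop := ∀ r s : ℝ, r ≠ 0 → X.ope r s a = 0

/-- Modes of a holomorphic operator of weight `h`: `a(z) = ∑_n a_n z^{-n-h}`. -/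
def mode (X : CFTData H) (h : ℝ) (a : H) (n : ℝ) : Module.End ℂ H := X.ope (-n - h) 0 a

/-- Modes of an antiholomorphic operator of weight `h`: `a(z̄) = ∑_n a_n z̄^{-n-h}`. -/
def modeBar (X : CFTData H) (h : ℝ) (a : H) (n : ℝ) : Module.End ℂ H := X.ope 0 (-n - h) a

/-- The holomorphic Virasoro modes. -/
def L (X : CFTData H) (n : ℝ) : Module.End ℂ H := X.mode 2 X.T n

/-- The antiholomorphic Virasoro modes. -/
def Lbar (X : CFTData H) (n : ℝ) : Module.End ℂ H := X.modeBar 2 X.Tbar n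

/-- The states of weights `(h, h')`. -/
def weightSpace (X : CFTData H) (h h' : ℝ) : Submodule ℂ H :=
  Module.End.eigenspace (X.L 0) (h : ℂ) ⊓ Module.End.eigenspace (X.Lbar 0) (h' : ℂ)

/-- `F` is the correlation function `⟨v | a(z) b(w) d⟩` on the configuration space of pairs of
distinct nonzero points: real analytic and single valued, and given by the two radially ordered
products (with the sign `ε` for exchanging `a` and `b`) and by the expansion of `a(z) b(w)` about
`w`, each of these being absolutely convergent up to the nearest other insertion. -/
structure IsCorrelator (X : CFTData H) (ε : ℂ) (v a b d : H) (F : ℂ → ℂ → ℂ) : Prop where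
  analytic : AnalyticOnNhd ℝ (fun p : ℂ × ℂ => F p.1 p.2) {p | p.1 ≠ 0 ∧ p.2 ≠ 0 ∧ p.1 ≠ p.2}
  ordered : ∀ z w : ℂ, 0 < ‖w‖ → ‖w‖ < ‖z‖ →
    HasSum (fun i : (ℝ × ℝ) × (ℝ × ℝ) => zPow i.1.1 i.1.2 z * zPow i.2.1 i.2.2 w *
      X.form v (X.ope i.1.1 i.1.2 a (X.ope i.2.1 i.2.2 b d))) (F z w)
  swapped : ∀ z w : ℂ, 0 < ‖z‖ → ‖z‖ < ‖w‖ →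
    HasSum (fun i : (ℝ × ℝ) × (ℝ × ℝ) => ε * (zPow i.1.1 i.1.2 w * zPow i.2.1 i.2.2 z *
      X.form v (X.ope i.1.1 i.1.2 b (X.ope i.2.1 i.2.2 a d)))) (F z w)
  fused : ∀ z w : ℂ, 0 < ‖z - w‖ → ‖z - w‖ < ‖w‖ →
    HasSum (fun i : (ℝ × ℝ) × (ℝ × ℝ) => zPow i.1.1 i.1.2 w * zPow i.2.1 i.2.2 (z - w) *
      X.form v (X.ope i.1.1 i.1.2 (X.ope i.2.1 i.2.2 a b) d)) (F z w)

/-- The axioms of a two-dimensional conformal field theory (in the NS sector when there are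
fermions). -/
structure IsCFT (X : CFTData H) : Prop where
  -- fermion parity
  fermion_sq : ∀ a, X.fermion (X.fermion a) = a
  fermion_ope : ∀ r s a b, X.fermion (X.ope r s a b) = X.ope r s (X.fermion a) (X.fermion b)
  fermion_vac : X.fermion X.vac = X.vac
  fermion_T : X.fermion X.T = X.T
  fermion_Tbar : X.fermion X.Tbar = X.Tbar
  -- the operator product is single valued and respects weights
  ope_int : ∀ r s a b, X.ope r s a b ≠ 0 → ∃ n : ℤ, r - s = n
  ope_weight : ∀ (r s h₁ k₁ h₂ k₂ : ℝ) (a b : H),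
    a ∈ X.weightSpace h₁ k₁ → b ∈ X.weightSpace h₂ k₂ →
      X.ope r s a b ∈ X.weightSpace (h₁ + h₂ + r) (k₁ + k₂ + s)
  -- states are finite sums of states of definite weights, with energy bounded below
  iSup_weightSpace : ⨆ p : ℝ × ℝ, X.weightSpace p.1 p.2 = ⊤
  energy_bddBelow : ∃ E : ℝ, ∀ h k : ℝ, X.weightSpace h k ≠ ⊥ → E ≤ h + k
  -- the vacuum and the state-operator correspondence
  vac_ope : ∀ r s b, X.ope r s X.vac b = if r = 0 ∧ s = 0 then b else 0
  ope_vac : ∀ r s a, X.ope r s a X.vac ≠ 0 → ∃ m n : ℕ, r = m ∧ s = n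
  ope_vac_zero : ∀ a, X.ope 0 0 a X.vac = a
  -- the energy-momentum tensors
  T_mem : X.T ∈ X.weightSpace 2 0
  Tbar_mem : X.Tbar ∈ X.weightSpace 0 2
  T_holomorphic : X.IsHolomorphic X.T
  Tbar_antiholomorphic : X.IsAntiholomorphic X.Tbar
  virasoro : IsVirasoro X.c X.L
  virasoro_bar : IsVirasoro X.cbar X.Lbar
  commute : ∀ m n : ℤ, X.L m * X.Lbar n = X.Lbar n * X.L m
  -- `L_{-1}` and its antiholomorphic partner generate translations
  translation : ∀ r s a b, X.ope r s (X.L (-1) a) b = ((r + 1 : ℝ) : ℂ) • X.ope (r + 1) s a b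
  translation_bar : ∀ r s a b,
    X.ope r s (X.Lbar (-1) a) b = ((s + 1 : ℝ) : ℂ) • X.ope r (s + 1) a b
  -- the inner product
  form_symm : ∀ v w, star (X.form v w) = X.form w v
  form_nondeg : ∀ w, (∀ v, X.form v w = 0) → w = 0
  form_orthogonal : ∀ (h₁ k₁ h₂ k₂ : ℝ) (v w : H), v ∈ X.weightSpace h₁ k₁ →
    w ∈ X.weightSpace h₂ k₂ → (h₁, k₁) ≠ (h₂, k₂) → X.form v w = 0
  -- locality and associativity of operator products
  correlator : ∀ (p q : ℕ) (v a b d : H), X.fermion a = (-1 : ℂ) ^ p • a →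
    X.fermion b = (-1 : ℂ) ^ q • b → ∃ F, X.IsCorrelator ((-1) ^ (p * q)) v a b d F

/-- The theory is unitary: the inner product is positive, `L_n† = L_{-n}`, and likewise for the
antiholomorphic modes. -/
structure IsUnitary (X : CFTData H) : Prop where
  pos : ∀ v, v ≠ 0 → 0 < (X.form v v).re
  L_adj : ∀ (n : ℤ) (v w : H), X.form (X.L n v) w = X.form v (X.L (-n) w)
  Lbar_adj : ∀ (n : ℤ) (v w : H), X.form (X.Lbar n v) w = X.form v (X.Lbar (-n) w)

/-- The Hamiltonian of radial quantization. -/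
def hamiltonian (X : CFTData H) : Module.End ℂ H := X.L 0 + X.Lbar 0

/-- The theory is non-degenerate: the Hamiltonian has discrete spectrum, that is, its eigenvalues
do not accumulate and have finite multiplicities. -/
structure IsNondegenerate (X : CFTData H) : Prop where
  discrete : ∀ R : ℝ, {E : ℝ | |E| ≤ R ∧ X.hamiltonian.HasEigenvalue (E : ℂ)}.Finite
  multiplicity : ∀ E : ℝ, FiniteDimensional ℂ (X.hamiltonian.eigenspace (E : ℂ))

/-- The modes of holomorphic currents `J, G⁺, G⁻` of weights `1, 3/2, 3/2`, together with those
of `T`. -/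
def modes (X : CFTData H) (N : N2Currents H) : N2Modes H where
  L := X.L
  J := X.mode 1 N.j
  Gp := X.mode (3 / 2) N.gp
  Gm := X.mode (3 / 2) N.gm

/-- The modes of antiholomorphic currents of weights `1, 3/2, 3/2`, together with those of the
antiholomorphic energy-momentum tensor. -/
def modesBar (X : CFTData H) (N : N2Currents H) : N2Modes H where
  L := X.Lbar
  J := X.modeBar 1 N.j
  Gp := X.modeBar (3 / 2) N.gp
  Gm := X.modeBar (3 / 2) N.gm

/-- The currents `N` make the holomorphic sector `N = 2` superconformal. -/
structure IsN2 (X : CFTData H) (N : N2Currents H) : Prop where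
  mem : N.j ∈ X.weightSpace 1 0 ∧ N.gp ∈ X.weightSpace (3 / 2) 0 ∧ N.gm ∈ X.weightSpace (3 / 2) 0
  parity : X.fermion N.j = N.j ∧ X.fermion N.gp = -N.gp ∧ X.fermion N.gm = -N.gm
  holomorphic : X.IsHolomorphic N.j ∧ X.IsHolomorphic N.gp ∧ X.IsHolomorphic N.gm
  algebra : (X.modes N).IsSuperVirasoro X.c

/-- The currents `N` make the antiholomorphic sector `N = 2` superconformal. -/
structure IsN2Bar (X : CFTData H) (N : N2Currents H) : Prop where
  mem : N.j ∈ X.weightSpace 0 1 ∧ N.gp ∈ X.weightSpace 0 (3 / 2) ∧ N.gm ∈ X.weightSpace 0 (3 / 2)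
  parity : X.fermion N.j = N.j ∧ X.fermion N.gp = -N.gp ∧ X.fermion N.gm = -N.gm
  antiholomorphic :
    X.IsAntiholomorphic N.j ∧ X.IsAntiholomorphic N.gp ∧ X.IsAntiholomorphic N.gm
  algebra : (X.modesBar N).IsSuperVirasoro X.cbar

/-- `x` is the product of the local operators `a` and `b` at the same point:
`x = lim_{z → 0} a(z, z̄) b(0)`, in matrix elements. -/
def IsProductAtPoint (X : CFTData H) (a b x : H) : Prop :=
  ∀ v : H, ∃ f : ℂ → ℂ,
    (∀ z : ℂ, z ≠ 0 → HasSum (fun i : ℝ × ℝ => zPow i.1 i.2 z * X.form v (X.ope i.1 i.2 a b)) (f z))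
      ∧ Tendsto f (𝓝[≠] 0) (𝓝 (X.form v x))

/-- The operators in `R` have non-singular operator products with each other, and under the product
at the same point they form an associative ring (indeed a `ℂ`-algebra) with unit the vacuum. -/
def IsPointRing (X : CFTData H) (R : Submodule ℂ H) : Prop :=
  (∀ a ∈ R, ∀ b ∈ R, ∀ r s : ℝ, X.ope r s a b ≠ 0 → 0 ≤ r ∧ 0 ≤ s) ∧
  ∃ μ : R →ₗ[ℂ] R →ₗ[ℂ] R,
    (∀ a b : R, X.IsProductAtPoint a b (μ a b)) ∧
    (∀ a b d : R, μ (μ a b) d = μ a (μ b d)) ∧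
    ∃ e : R, (e : H) = X.vac ∧ ∀ a : R, μ e a = a ∧ μ a e = a

/-- The space `R_c` spanned by the chiral primary operators `O(z)` of the holomorphic sector. -/
def chiralRing (X : CFTData H) (N : N2Currents H) : Submodule ℂ H :=
  Submodule.span ℂ {v | X.IsHolomorphic v ∧ ∃ h q : ℝ, (X.modes N).IsChiralPrimary h q v}

/-- The space `R_cc` spanned by the operators that are chiral primaries of both sectors. -/
def chiralChiralRing (X : CFTData H) (N N' : N2Currents H) : Submodule ℂ H :=
  Submodule.span ℂ {v | (∃ h q : ℝ, (X.modes N).IsChiralPrimary h q v) ∧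
    ∃ h q : ℝ, (X.modesBar N').IsChiralPrimary h q v}

end CFTData

end

/-!
The argument rests on three facts.

*Residues are derivations.*  For a holomorphic field `g`, the mode `ope (-1) 0 g` is the contour
integral of `g(z)`.  Evaluated between states of definite weight, `⟨v | g(z) a(1) b⟩` is a function
on `ℂ ∖ {0, 1}` with Laurent expansions at `0`, `1` and `∞`; it is real analytic, and holomorphic
because it is so near `0`.  The residue theorem (`residue_infty_eq_add`) then says that
`ope (-1) 0 g` is a superderivation of the operator product (`CFTData.IsCFT.residue_ope`).  This
applies to `J₀` and to `Q = G⁺_{-1/2}`.  Exchanging the two sectors by complex conjugation of the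
coordinate (`CFTData.mirror`) gives the same for the antiholomorphic currents.

*Positivity.*  The operator `2 L₀ - J₀ = {Q, Q†}` is nonnegative.  Its kernel consists of the states
killed by `Q` and `Q† = G⁻_{1/2}`, and the eigenstates of `L₀`, `J₀` in the kernel are exactly the
chiral primaries, since all other positive modes lower `2 L₀ - J₀`
(`N2Modes.isChiralPrimary_of_chiralGap`).  As `2 L₀ - J₀` takes the value `2 r` on `a_{[r,s]} b` for
chiral `a`, `b`, singular terms vanish and the terms with `r = 0` are chiral primary.  The bound
`h ≤ c / 6` is `⟨v | {G⁺_{-3/2}, G⁻_{3/2}} | v⟩ ≥ 0`.  With discrete spectrum, bounded weights leave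
room for finitely many chiral primaries only.  Holomorphic operators are, likewise by positivity,
those in the kernel of `L̄₀` (`CFTData.IsCFT.isHolomorphic_iff`), so both chiral rings are
intersections of two kernels.

*Topological correlation functions.*  On chiral states `L₋₁ = ½ Q G⁻_{-1/2}`, so the terms with
`r ≠ 0` of an operator product of chiral states are `Q`-exact, and by the derivation property and
`Q† v = 0` they drop out of all matrix elements between chiral states.  Hence the three-fold
correlation functions are constant, with value `⟨v | a (b d)⟩` according to one expansion and
`⟨v | (a b) d⟩` according to the other.  As the two domains of convergence overlap, the product at
the same point is associative (`CFTData.IsCFT.isPointRing_of_topological`).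
-/

/-! ### A residue identity on the twice punctured plane -/

/-- Splitting of a Laurent series about `c` with finite principal part into a holomorphic function
on the full disc and the principal part. -/
theorem exists_holomorphic_add_principalPart {f : ℂ → ℂ} {Q : ℤ → ℂ} {c : ℂ} {N : ℕ}
    (hQ : ∀ z, 0 < ‖z - c‖ → ‖z - c‖ < 1 → HasSum (fun n : ℤ => Q n * (z - c) ^ n) (f z))
    (hN : ∀ n : ℤ, n < -N → Q n = 0) :
    ∃ q : ℂ → ℂ, DifferentiableOn ℂ q (Metric.ball c 1) ∧ ∀ z, 0 < ‖z - c‖ → ‖z - c‖ < 1 →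
      f z = q z + ∑ k ∈ Finset.range N, Q (-(k + 1 : ℤ)) * (z - c) ^ (-(k + 1 : ℤ)) := by
  refine ⟨fun z => ∑' n : ℕ, Q n * (z - c) ^ n, ?_, ?_⟩
  · intro z₀ hz₀
    rw [Metric.mem_ball, dist_eq_norm] at hz₀
    obtain ⟨ρ, h1, h2⟩ := exists_between hz₀
    have hρ : 0 < ρ := (norm_nonneg _).trans_lt h1
    have hs : Summable fun n : ℕ => ‖Q n‖ * ρ ^ n := by
      have h := (hQ (c + ρ) (by simpa using hρ.ne') (by simpa [abs_of_pos hρ] using h2)).summable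
      have h' := h.norm.comp_injective (Nat.cast_injective (R := ℤ))
      refine h'.congr fun n => ?_
      simp [abs_of_pos hρ]
    have hd : DifferentiableOn ℂ (fun z => ∑' n : ℕ, Q n * (z - c) ^ n) (Metric.ball c ρ) := by
      refine Complex.differentiableOn_tsum_of_summable_norm hs (fun n => by fun_prop)
        Metric.isOpen_ball fun n w hw => ?_
      rw [Metric.mem_ball, dist_eq_norm] at hw
      rw [norm_mul, norm_pow]
      gcongr
    exact (hd.differentiableAt (Metric.isOpen_ball.mem_nhds
      (by rwa [Metric.mem_ball, dist_eq_norm]))).differentiableWithinAt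
  · intro z h0 h1
    have h := hQ z h0 h1
    have hneg : HasSum (fun k : ℕ => Q (-(k + 1 : ℤ)) * (z - c) ^ (-(k + 1 : ℤ)))
        (∑ k ∈ Finset.range N, Q (-(k + 1 : ℤ)) * (z - c) ^ (-(k + 1 : ℤ))) := by
      refine hasSum_sum_of_ne_finset_zero fun k hk => ?_
      rw [Finset.mem_range, not_lt] at hk
      rw [hN _ (by omega), zero_mul]
    have hpos : Summable fun n : ℕ => Q n * (z - c) ^ n := by
      refine (h.summable.comp_injective (Nat.cast_injective (R := ℤ))).congr fun n => ?_
      simp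
    have h2 := HasSum.of_nat_of_neg_add_one (f := fun n : ℤ => Q n * (z - c) ^ n)
      (by simpa using hpos.hasSum) hneg
    exact h.unique h2

/-- A real analytic function on `ℂ ∖ {0, 1}` that is holomorphic on the punctured unit disc is
holomorphic: its `∂̄`-derivative is real analytic and vanishes on an open set. -/
theorem differentiableAt_of_real_analytic {f : ℂ → ℂ}
    (hf : ∀ z, z ≠ 0 → z ≠ 1 → AnalyticAt ℝ f z)
    (hd : ∀ z, z ≠ 0 → ‖z‖ < 1 → DifferentiableAt ℂ f z) (z : ℂ) (h0 : z ≠ 0) (h1 : z ≠ 1) :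
    DifferentiableAt ℂ f z := by
  have hU : IsPreconnected (({0, 1} : Set ℂ)ᶜ) :=
    (Set.Countable.isConnected_compl_of_one_lt_rank (by simp)
      (Set.toFinite _).countable).isPreconnected
  have hfd : ∀ z, z ≠ 0 → z ≠ 1 → AnalyticAt ℝ (fderiv ℝ f) z :=
    fun z h0 h1 => (hf z h0 h1).fderiv
  have han : AnalyticOnNhd ℝ (fun z => fderiv ℝ f z Complex.I - Complex.I * fderiv ℝ f z 1)
      ({0, 1} : Set ℂ)ᶜ := by
    intro z hz
    simp only [Set.mem_compl_iff, Set.mem_insert_iff, Set.mem_singleton_iff, not_or] at hz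
    have h := hfd z hz.1 hz.2
    exact ((ContinuousLinearMap.apply ℝ ℂ Complex.I).analyticAt _ |>.comp h).sub
      (analyticAt_const.mul ((ContinuousLinearMap.apply ℝ ℂ (1 : ℂ)).analyticAt _ |>.comp h))
  have hev : (fun z => fderiv ℝ f z Complex.I - Complex.I * fderiv ℝ f z 1) =ᶠ[𝓝 (1 / 2 : ℂ)] 0 := by
    have hopen : IsOpen {z : ℂ | z ≠ 0 ∧ ‖z‖ < 1} :=
      isOpen_ne.inter (isOpen_lt continuous_norm continuous_const)
    filter_upwards [hopen.mem_nhds (x := (1 / 2 : ℂ)) ⟨by norm_num, by norm_num⟩] with w hw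
    have := (differentiableAt_complex_iff_differentiableAt_real.1 (hd w hw.1 hw.2)).2
    simp [this]
  have h := han.eqOn_zero_of_preconnected_of_eventuallyEq_zero hU
    (by norm_num : (1 / 2 : ℂ) ∈ ({0, 1} : Set ℂ)ᶜ) hev
    (x := z) (by simp [h0, h1])
  refine differentiableAt_complex_iff_differentiableAt_real.2
    ⟨(hf z h0 h1).differentiableAt, ?_⟩
  simpa [sub_eq_zero] using h

theorem circleIntegral_laurent {f : ℂ → ℂ} {P : ℤ → ℂ} {R : ℝ} (hR : 0 < R)
    (hP : ∀ z, ‖z‖ = R → HasSum (fun n : ℤ => P n * z ^ n) (f z)) :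
    (∮ z in C(0, R), f z) = 2 * Real.pi * Complex.I * P (-1) := by
  have hterm : ∀ n : ℤ, n ≠ -1 → (∮ z in C(0, R), P n * z ^ n) = 0 := by
    intro n hn
    have := circleIntegral.integral_sub_zpow_of_ne hn 0 0 R
    simp only [sub_zero] at this
    rw [circleIntegral.integral_const_mul, this, mul_zero]
  have hone : (∮ z in C(0, R), P (-1) * z ^ (-1 : ℤ)) = 2 * Real.pi * Complex.I * P (-1) := by
    have := circleIntegral.integral_sub_inv_of_mem_ball (c := 0) (w := 0) (R := R) (by simpa using hR)
    simp only [sub_zero] at this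
    rw [circleIntegral.integral_const_mul]
    simp only [zpow_neg_one, this]
    ring
  have hsum : HasSum (fun n : ℤ => ∮ z in C(0, R), P n * z ^ n) (∮ z in C(0, R), f z) := by
    unfold circleIntegral
    have hnorm : ∀ θ, ‖circleMap 0 R θ‖ = R := fun θ => by simp [abs_of_pos hR]
    refine intervalIntegral.hasSum_integral_of_dominated_convergence
      (fun n _ => R * ‖P n * (R : ℂ) ^ n‖) (fun n => ?_) (fun n => ?_) ?_ ?_ ?_
    · refine Continuous.aestronglyMeasurable ?_
      have : ∀ θ, circleMap 0 R θ ≠ 0 := fun θ => circleMap_ne_center hR.ne'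
      simp only [deriv_circleMap]
      exact ((continuous_circleMap 0 R).mul continuous_const).smul
        (continuous_const.mul ((continuous_circleMap 0 R).zpow₀ n fun θ => .inl (this θ)))
    · refine Eventually.of_forall fun θ _ => le_of_eq ?_
      simp [deriv_circleMap, abs_of_pos hR]
    · refine Eventually.of_forall fun θ _ => ?_
      exact ((hP R (by simp [abs_of_pos hR])).summable.norm).mul_left R
    · exact intervalIntegrable_const
    · refine Eventually.of_forall fun θ _ => ?_
      exact (hP _ (hnorm θ)).const_smul (deriv (circleMap 0 R) θ)
  rw [← hone]
  exact hsum.unique (hasSum_single (-1) hterm)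

/-- The residue of a finite principal part at a point inside the circle. -/
theorem circleIntegral_principalPart (Q : ℤ → ℂ) {c : ℂ} {N : ℕ} {R : ℝ}
    (hc : c ∈ Metric.ball (0 : ℂ) R) (hN : ∀ n : ℤ, n < -N → Q n = 0) :
    CircleIntegrable
      (fun z => ∑ k ∈ Finset.range N, Q (-(k + 1 : ℤ)) * (z - c) ^ (-(k + 1 : ℤ))) 0 R ∧
    (∮ z in C(0, R), ∑ k ∈ Finset.range N, Q (-(k + 1 : ℤ)) * (z - c) ^ (-(k + 1 : ℤ))) =
      2 * Real.pi * Complex.I * Q (-1) := by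
  have hR : 0 < R := Metric.pos_of_mem_ball hc
  have hne : ∀ z ∈ Metric.sphere (0 : ℂ) R, z - c ≠ 0 := fun z hz h => by
    rw [sub_eq_zero] at h
    subst h
    exact (Metric.sphere_disjoint_ball.le_bot ⟨hz, hc⟩ : z ∈ (∅ : Set ℂ)).elim
  have hint : ∀ k : ℕ, CircleIntegrable
      (fun z => Q (-(k + 1 : ℤ)) * (z - c) ^ (-(k + 1 : ℤ))) 0 R := fun k =>
    ContinuousOn.circleIntegrable hR.le (continuousOn_const.mul
      ((continuousOn_id.sub continuousOn_const).zpow₀ _ fun z hz => .inl (hne z hz)))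
  refine ⟨CircleIntegrable.fun_sum _ fun k _ => hint k, ?_⟩
  rw [circleIntegral.integral_fun_sum fun k _ => hint k]
  have hk : ∀ k : ℕ, (∮ z in C(0, R), Q (-(k + 1 : ℤ)) * (z - c) ^ (-(k + 1 : ℤ))) =
      if k = 0 then 2 * Real.pi * Complex.I * Q (-1) else 0 := by
    intro k
    rw [circleIntegral.integral_const_mul]
    split_ifs with h
    · subst h
      have := circleIntegral.integral_sub_inv_of_mem_ball hc
      simp only [Nat.cast_zero, zero_add, zpow_neg_one, this]
      ring
    · rw [circleIntegral.integral_sub_zpow_of_ne (by omega), mul_zero]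
  simp_rw [hk]
  rw [Finset.sum_ite_eq']
  split_ifs with h
  · rfl
  · rw [hN (-1) (by simp at h; omega), mul_zero]

/-- The residue theorem for a function on `ℂ ∖ {0, 1}`, in terms of its Laurent coefficients `P` at
infinity, `Q` at `0` and `R` at `1`. -/
theorem residue_infty_eq_add {f : ℂ → ℂ} {P Q R : ℤ → ℂ} {N : ℕ}
    (hf : ∀ z, z ≠ 0 → z ≠ 1 → AnalyticAt ℝ f z)
    (hP : ∀ z, 1 < ‖z‖ → HasSum (fun n : ℤ => P n * z ^ n) (f z))
    (hQ : ∀ z, 0 < ‖z‖ → ‖z‖ < 1 → HasSum (fun n : ℤ => Q n * z ^ n) (f z))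
    (hR : ∀ z, 0 < ‖z - 1‖ → ‖z - 1‖ < 1 → HasSum (fun n : ℤ => R n * (z - 1) ^ n) (f z))
    (hQN : ∀ n : ℤ, n < -N → Q n = 0) (hRN : ∀ n : ℤ, n < -N → R n = 0) :
    P (-1) = Q (-1) + R (-1) := by
  obtain ⟨q, hq, hfq⟩ := exists_holomorphic_add_principalPart (c := 0) (f := f)
    (by simpa using hQ) hQN
  obtain ⟨t, ht, hft⟩ := exists_holomorphic_add_principalPart (c := 1) hR hRN
  set A : ℂ → ℂ := fun z => ∑ k ∈ Finset.range N, Q (-(k + 1 : ℤ)) * (z - 0) ^ (-(k + 1 : ℤ)) with hA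
  set B : ℂ → ℂ := fun z => ∑ k ∈ Finset.range N, R (-(k + 1 : ℤ)) * (z - 1) ^ (-(k + 1 : ℤ)) with hB
  have hAd : ∀ z, z ≠ 0 → DifferentiableAt ℂ A z := fun z hz => by
    refine DifferentiableAt.fun_sum fun k _ => ?_
    exact ((differentiableAt_id.sub_const 0).zpow (.inl (by simpa using hz))).const_mul _
  have hBd : ∀ z, z ≠ 1 → DifferentiableAt ℂ B z := fun z hz => by
    refine DifferentiableAt.fun_sum fun k _ => ?_
    exact ((differentiableAt_id.sub_const 1).zpow (.inl (by simpa [sub_eq_zero] using hz))).const_mul _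
  have hfd : ∀ z, z ≠ 0 → z ≠ 1 → DifferentiableAt ℂ f z := by
    refine differentiableAt_of_real_analytic hf fun z h0 h1 => ?_
    have hopen : IsOpen {z : ℂ | z ≠ 0 ∧ ‖z‖ < 1} :=
      isOpen_ne.inter (isOpen_lt continuous_norm continuous_const)
    have hqz : DifferentiableAt ℂ q z :=
      hq.differentiableAt (Metric.isOpen_ball.mem_nhds (by simpa using h1))
    refine (hqz.add (hAd z h0)).congr_of_eventuallyEq ?_
    filter_upwards [hopen.mem_nhds ⟨h0, h1⟩] with w hw
    exact hfq w (by simpa using hw.1) (by simpa using hw.2)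
  -- removing both principal parts leaves an entire function
  set g : ℂ → ℂ := fun z => if z = 0 then q 0 - B 0 else if z = 1 then t 1 - A 1 else
    f z - A z - B z with hg
  have hgd : ∀ z, DifferentiableAt ℂ g z := by
    intro z
    by_cases h0 : z = 0
    · subst h0
      have h1 : DifferentiableAt ℂ (fun z => q z - B z) 0 :=
        (hq.differentiableAt (Metric.isOpen_ball.mem_nhds (by simp))).sub (hBd 0 (by simp))
      refine h1.congr_of_eventuallyEq ?_
      filter_upwards [Metric.ball_mem_nhds (0 : ℂ) one_pos] with w hw
      have hw1 : w ≠ 1 := by rintro rfl; simp at hw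
      by_cases hw0 : w = 0
      · simp [hg, hw0]
      · simp only [hg, hw0, hw1, if_false]
        rw [hfq w (by simpa using hw0) (by simpa using hw)]
        simp only [hA]
        ring
    by_cases h1 : z = 1
    · subst h1
      have h1 : DifferentiableAt ℂ (fun z => t z - A z) 1 :=
        (ht.differentiableAt (Metric.isOpen_ball.mem_nhds (by simp))).sub (hAd 1 (by simp))
      refine h1.congr_of_eventuallyEq ?_
      filter_upwards [Metric.ball_mem_nhds (1 : ℂ) one_pos] with w hw
      have hw0 : w ≠ 0 := by rintro rfl; simp at hw
      by_cases hw1 : w = 1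
      · simp [hg, hw1]
      · simp only [hg, hw0, hw1, if_false]
        rw [hft w (by simpa [sub_eq_zero] using hw1) (by simpa [dist_eq_norm] using hw)]
        simp only [hB]
        ring
    · refine (((hfd z h0 h1).sub (hAd z h0)).sub (hBd z h1)).congr_of_eventuallyEq ?_
      filter_upwards [isOpen_ne.mem_nhds h0, isOpen_ne.mem_nhds h1] with w hw0 hw1
      simp [hg, hw0, hw1]
  have hgint : (∮ z in C(0, 2), g z) = 0 :=
    Complex.circleIntegral_eq_zero_of_differentiable_on_off_countable (by norm_num)
      Set.countable_empty (fun z _ => (hgd z).continuousAt.continuousWithinAt) fun z _ => hgd z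
  obtain ⟨hAi, hAv⟩ := circleIntegral_principalPart Q (c := 0) (R := 2) (by simp) hQN
  obtain ⟨hBi, hBv⟩ := circleIntegral_principalPart R (c := 1) (R := 2) (by simp) hRN
  have hfe : (∮ z in C(0, 2), f z) = ∮ z in C(0, 2), (g z + A z + B z) := by
    refine circleIntegral.integral_congr (by norm_num) fun z hz => ?_
    rw [mem_sphere_zero_iff_norm] at hz
    have h0 : z ≠ 0 := by rintro rfl; norm_num at hz
    have h1 : z ≠ 1 := by rintro rfl; norm_num at hz
    simp only [hg, h0, h1, if_false]
    ring
  have hgi : CircleIntegrable g 0 2 := ContinuousOn.circleIntegrable (by norm_num)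
    fun z _ => (hgd z).continuousAt.continuousWithinAt
  have hadd : (∮ z in C(0, 2), (g z + A z + B z)) =
      (∮ z in C(0, 2), g z) + (∮ z in C(0, 2), A z) + ∮ z in C(0, 2), B z := by
    rw [← circleIntegral.integral_add hgi hAi]
    exact circleIntegral.integral_add (hgi.add hAi) hBi
  rw [hadd, hgint, hAv, hBv,
    circleIntegral_laurent (by norm_num) fun z hz => hP z (by rw [hz]; norm_num)] at hfe
  have hpi : (2 * Real.pi * Complex.I : ℂ) ≠ 0 := by simp [Real.pi_ne_zero]
  refine mul_left_cancel₀ hpi ?_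
  rw [hfe]
  ring

/-! ### The functions `z^r * conj(z)^s` -/

theorem zPow_one (r s : ℝ) : zPow r s 1 = 1 := by simp [zPow]

theorem zPow_zero_zero (z : ℂ) : zPow 0 0 z = 1 := by simp [zPow]

theorem norm_zPow (r s : ℝ) (z : ℂ) : ‖zPow r s z‖ = ‖z‖ ^ (r + s) := by
  have h : Complex.I * ((r - s : ℝ) : ℂ) * (z.arg : ℂ) = (((r - s) * z.arg : ℝ) : ℂ) * Complex.I := by
    push_cast
    ring
  rw [zPow, norm_mul, h, Complex.norm_exp_ofReal_mul_I, mul_one, Complex.norm_real,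
    Real.norm_of_nonneg (Real.rpow_nonneg (norm_nonneg z) _)]

theorem zPow_intCast_zero (n : ℤ) (z : ℂ) : zPow n 0 z = z ^ n := by
  conv_rhs => rw [← Complex.norm_mul_exp_arg_mul_I z]
  rw [mul_zpow, ← Complex.exp_int_mul, zPow, add_zero, Real.rpow_intCast]
  push_cast
  ring_nf

/-- Integrality of `r - s` matters on the branch cut, where `arg (conj z) = arg z = π`. -/
theorem zPow_conj {r s : ℝ} (h : ∃ n : ℤ, r - s = n) (z : ℂ) :
    zPow r s (starRingEnd ℂ z) = zPow s r z := by
  obtain ⟨n, hn⟩ := h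
  have hn' : s - r = -n := by linarith
  rw [zPow, zPow, Complex.norm_conj, add_comm s r, Complex.arg_conj, hn, hn']
  split_ifs with hπ
  · rw [hπ]
    congr 1
    rw [Complex.exp_eq_exp_iff_exists_int]
    exact ⟨n, by push_cast; ring⟩
  · push_cast
    ring_nf

/-- Reduction of a sum over pairs of exponents to a Laurent series, when the first operator is
holomorphic and the weights fix the total exponents `ρ` and `σ`. -/
theorem hasSum_int_of_support {t : (ℝ × ℝ) × (ℝ × ℝ) → ℂ} {x : ℂ} (h : HasSum t x) (ρ σ : ℝ)
    (ht : ∀ i, t i ≠ 0 → i.1.2 = 0 ∧ (∃ n : ℤ, i.1.1 = n) ∧ i.1.1 + i.2.1 = ρ ∧ i.2.2 = σ) :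
    HasSum (fun n : ℤ => t ((n, 0), (ρ - n, σ))) x := by
  have hinj : Function.Injective fun n : ℤ => (((n : ℝ), (0 : ℝ)), (ρ - n, σ)) := by
    intro m n hmn
    simpa using congrArg (fun i => i.1.1) hmn
  refine (hinj.hasSum_iff fun i hi => ?_).2 h
  by_contra hne
  obtain ⟨h1, ⟨n, hn⟩, h2, h3⟩ := ht i hne
  refine hi ⟨n, ?_⟩
  obtain ⟨⟨i1, i2⟩, ⟨j1, j2⟩⟩ := i
  simp only at h1 hn h2 h3
  subst h1 hn h3
  simp [← h2]

namespace CFTData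

variable {H : Type*} [AddCommGroup H] [Module ℂ H] {X : CFTData H}

/-! ### Weight spaces -/

theorem mem_weightSpace {h k : ℝ} {v : H} :
    v ∈ X.weightSpace h k ↔ X.L 0 v = (h : ℂ) • v ∧ X.Lbar 0 v = (k : ℂ) • v := by
  simp [weightSpace]

namespace IsCFT

variable (hX : X.IsCFT)
include hX

theorem fermion_mem {h k : ℝ} {v : H} (hv : v ∈ X.weightSpace h k) :
    X.fermion v ∈ X.weightSpace h k := by
  rw [mem_weightSpace] at hv ⊢
  have h1 := congrArg X.fermion hv.1
  have h2 := congrArg X.fermion hv.2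
  simp only [L, mode, Lbar, modeBar, hX.fermion_ope, hX.fermion_T, hX.fermion_Tbar, map_smul]
    at h1 h2 ⊢
  exact ⟨h1, h2⟩

theorem weight_induction {P : H → Prop} (mem : ∀ h k, ∀ v ∈ X.weightSpace h k, P v)
    (add : ∀ v w, P v → P w → P (v + w)) (v : H) : P v := by
  have hv : v ∈ ⨆ p : ℝ × ℝ, X.weightSpace p.1 p.2 := by
    rw [hX.iSup_weightSpace]
    trivial
  exact Submodule.iSup_induction _ (motive := P) hv (fun p x hx => mem _ _ x hx)
    (mem 0 0 0 (Submodule.zero_mem _)) add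

/-- Every element of a submodule stable under the fermion parity is a sum of elements of definite
parity in that submodule. -/
theorem parity_induction {R : Submodule ℂ H} (hR : ∀ v ∈ R, X.fermion v ∈ R) {P : H → Prop}
    (mem : ∀ (q : ℕ), ∀ v ∈ R, X.fermion v = (-1 : ℂ) ^ q • v → P v)
    (add : ∀ v w, P v → P w → P (v + w)) {v : H} (hv : v ∈ R) : P v := by
  have hsplit : v = (1 / 2 : ℂ) • (v + X.fermion v) + (1 / 2 : ℂ) • (v - X.fermion v) := by
    module
  have hF := hR v hv
  rw [hsplit]
  refine add _ _ (mem 0 _ (Submodule.smul_mem _ _ (add_mem hv hF)) ?_)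
    (mem 1 _ (Submodule.smul_mem _ _ (sub_mem hv hF)) ?_)
  · rw [map_smul, map_add, hX.fermion_sq]
    module
  · rw [map_smul, map_sub, hX.fermion_sq]
    module

theorem weight_parity_induction {P : H → Prop}
    (mem : ∀ h k (q : ℕ), ∀ v ∈ X.weightSpace h k, X.fermion v = (-1 : ℂ) ^ q • v → P v)
    (add : ∀ v w, P v → P w → P (v + w)) (v : H) : P v :=
  hX.weight_induction (fun h k _ hv =>
    hX.parity_induction (fun _ => hX.fermion_mem) (mem h k) add hv) add v

theorem ext_form {x y : H} (h : ∀ v, X.form v x = X.form v y) : x = y :=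
  sub_eq_zero.1 (hX.form_nondeg _ fun v => by rw [map_sub, h, sub_self])

theorem ext_form_weight {x y : H}
    (h : ∀ m n, ∀ v ∈ X.weightSpace m n, X.form v x = X.form v y) : x = y :=
  hX.ext_form <| hX.weight_induction h fun v w hv hw => by
    simp only [map_add, LinearMap.add_apply, hv, hw]

theorem weight_eq_of_form_ne_zero {h k h' k' : ℝ} {v w : H} (hv : v ∈ X.weightSpace h k)
    (hw : w ∈ X.weightSpace h' k') (hne : X.form v w ≠ 0) : h = h' ∧ k = k' := by
  by_contra hcon
  exact hne (hX.form_orthogonal _ _ _ _ v w hv hw fun he => hcon (Prod.mk.inj he))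

/-! ### Residues of holomorphic fields act as derivations -/

/-- The matrix elements of the derivation property, from the residue theorem for the function
`z ↦ ⟨v | g(z) a(1) b⟩`. -/
theorem form_residue_ope {g a b v : H} {hg ha ka hb kb hv kv : ℝ} {p q : ℕ}
    (hgW : g ∈ X.weightSpace hg 0) (hol : X.IsHolomorphic g)
    (hgF : X.fermion g = (-1 : ℂ) ^ p • g) (haF : X.fermion a = (-1 : ℂ) ^ q • a)
    (haW : a ∈ X.weightSpace ha ka) (hbW : b ∈ X.weightSpace hb kb)
    (hvW : v ∈ X.weightSpace hv kv) (r s : ℝ) :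
    X.form v (X.ope (-1) 0 g (X.ope r s a b)) =
      X.form v (X.ope r s (X.ope (-1) 0 g a) b) +
        (-1) ^ (p * q) * X.form v (X.ope r s a (X.ope (-1) 0 g b)) := by
  by_cases hm : hv = hg + ha + hb + r - 1 ∧ kv = ka + kb + s
  swap
  -- if the weights of `v` do not match, all three terms vanish by orthogonality
  · have key : ∀ x ∈ X.weightSpace (hg + ha + hb + r - 1) (ka + kb + s), X.form v x = 0 :=
      fun x hx => by
        by_contra hne
        exact hm (hX.weight_eq_of_form_ne_zero hvW hx hne)
    rw [key, key, key]
    · simp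
    · convert hX.ope_weight r s _ _ _ _ _ _ haW (hX.ope_weight (-1) 0 _ _ _ _ _ _ hgW hbW) using 2 <;>
        ring
    · convert hX.ope_weight r s _ _ _ _ _ _ (hX.ope_weight (-1) 0 _ _ _ _ _ _ hgW haW) hbW using 2 <;>
        ring
    · convert hX.ope_weight (-1) 0 _ _ _ _ _ _ hgW (hX.ope_weight r s _ _ _ _ _ _ haW hbW) using 2 <;>
        ring
  obtain ⟨hm1, hm2⟩ := hm
  obtain ⟨F, hF⟩ := hX.correlator p q v g a b hgF haF
  obtain ⟨E, hE⟩ := hX.energy_bddBelow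
  obtain ⟨N, hN⟩ := exists_nat_ge (max (hg + hb + kb - E) (hg + ha + ka - E))
  -- the lower bound on the energy makes the principal parts at `0` and `1` finite
  have low : ∀ (x : H) (hx kx : ℝ), x ∈ X.weightSpace hx kx → hg + hx + kx - E ≤ N →
      ∀ n : ℤ, n < -N → X.ope n 0 g x = 0 := by
    intro x hx kx hxW hle n hn
    by_contra hne
    have h1 := hX.ope_weight n 0 _ _ _ _ _ _ hgW hxW
    have h2 := hE _ _ (fun hbot => hne ((Submodule.eq_bot_iff _).1 hbot _ h1))
    have h3 : (n : ℝ) < -N := by exact_mod_cast hn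
    linarith
  have hint : ∀ (i1 i2 : ℝ) (x : H), X.ope i1 i2 g x ≠ 0 → i2 = 0 ∧ ∃ n : ℤ, i1 = n := by
    intro i1 i2 x hne
    have h2 : i2 = 0 := by
      by_contra h
      exact hne (by rw [hol _ _ h, LinearMap.zero_apply])
    subst h2
    obtain ⟨n, hn⟩ := hX.ope_int _ _ _ _ hne
    exact ⟨rfl, n, by simpa using hn⟩
  have main := residue_infty_eq_add (f := fun z => F z 1) (N := N)
    (P := fun n => X.form v (X.ope n 0 g (X.ope (r - 1 - n) s a b)))
    (Q := fun n => (-1) ^ (p * q) * X.form v (X.ope (r - 1 - n) s a (X.ope n 0 g b)))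
    (R := fun n => X.form v (X.ope (r - 1 - n) s (X.ope n 0 g a) b)) ?_ ?_ ?_ ?_ ?_ ?_
  · have e1 : r - 1 - ((-1 : ℤ) : ℝ) = r := by push_cast; ring
    simp only [e1] at main
    rw [add_comm]
    simpa using main
  · intro z h0 h1
    exact (hF.analytic (z, 1) ⟨h0, one_ne_zero, h1⟩).comp (f := fun z : ℂ => (z, (1 : ℂ)))
      (analyticAt_id.prod analyticAt_const)
  · intro z hz
    refine (hasSum_int_of_support (hF.ordered z 1 (by simp) (by simpa using hz))
      (r - 1) s ?_).congr_fun ?_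
    · rintro ⟨⟨i1, i2⟩, ⟨j1, j2⟩⟩ hne
      have hne : X.form v (X.ope i1 i2 g (X.ope j1 j2 a b)) ≠ 0 := right_ne_zero_of_mul hne
      obtain ⟨h2, n, hn⟩ := hint i1 i2 (X.ope j1 j2 a b) fun h => hne (by simp [h])
      obtain ⟨e1, e2⟩ := hX.weight_eq_of_form_ne_zero hvW
        (hX.ope_weight _ _ _ _ _ _ _ _ hgW (hX.ope_weight _ _ _ _ _ _ _ _ haW hbW)) hne
      exact ⟨h2, ⟨n, hn⟩, by simp only at *; linarith, by simp only at *; linarith⟩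
    · intro n
      simp only [zPow_one, zPow_intCast_zero]
      ring
  · intro z h0 h1
    refine (hasSum_int_of_support ((Equiv.prodComm _ _).hasSum_iff.2
      (hF.swapped z 1 h0 (by simpa using h1))) (r - 1) s ?_).congr_fun ?_
    · rintro ⟨⟨i1, i2⟩, ⟨j1, j2⟩⟩ hne
      have hne : X.form v (X.ope j1 j2 a (X.ope i1 i2 g b)) ≠ 0 :=
        right_ne_zero_of_mul (right_ne_zero_of_mul hne)
      obtain ⟨h2, n, hn⟩ := hint i1 i2 b fun h => hne (by simp [h])
      obtain ⟨e1, e2⟩ := hX.weight_eq_of_form_ne_zero hvW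
        (hX.ope_weight _ _ _ _ _ _ _ _ haW (hX.ope_weight _ _ _ _ _ _ _ _ hgW hbW)) hne
      exact ⟨h2, ⟨n, hn⟩, by simp only at *; linarith, by simp only at *; linarith⟩
    · intro n
      simp only [Function.comp, Equiv.prodComm_apply, Prod.swap, zPow_one, zPow_intCast_zero]
      ring
  · intro z h0 h1
    refine (hasSum_int_of_support ((Equiv.prodComm _ _).hasSum_iff.2
      (hF.fused z 1 h0 (by simpa using h1))) (r - 1) s ?_).congr_fun ?_
    · rintro ⟨⟨i1, i2⟩, ⟨j1, j2⟩⟩ hne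
      have hne : X.form v (X.ope j1 j2 (X.ope i1 i2 g a) b) ≠ 0 := right_ne_zero_of_mul hne
      obtain ⟨h2, n, hn⟩ := hint i1 i2 a fun h => hne (by simp [h])
      obtain ⟨e1, e2⟩ := hX.weight_eq_of_form_ne_zero hvW
        (hX.ope_weight _ _ _ _ _ _ _ _ (hX.ope_weight _ _ _ _ _ _ _ _ hgW haW) hbW) hne
      exact ⟨h2, ⟨n, hn⟩, by simp only at *; linarith, by simp only at *; linarith⟩
    · intro n
      simp only [Function.comp, Equiv.prodComm_apply, Prod.swap, zPow_one, zPow_intCast_zero]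
      ring
  · intro n hn
    simp [low b hb kb hbW ((le_max_left _ _).trans hN) n hn]
  · intro n hn
    simp [low a ha ka haW ((le_max_right _ _).trans hN) n hn]

/-- The residue of a holomorphic field of parity `p` is a superderivation of the operator
product. -/
theorem residue_ope {g : H} {hg : ℝ} {p : ℕ} (hgW : g ∈ X.weightSpace hg 0)
    (hol : X.IsHolomorphic g) (hgF : X.fermion g = (-1 : ℂ) ^ p • g) (r s : ℝ) (a b : H) :
    X.ope (-1) 0 g (X.ope r s a b) =
      X.ope r s (X.ope (-1) 0 g a) b + X.ope r s ((X.fermion ^ p) a) (X.ope (-1) 0 g b) := by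
  have hpow : ∀ (n q : ℕ) (a : H), X.fermion a = (-1 : ℂ) ^ q • a →
      (X.fermion ^ n) a = (-1 : ℂ) ^ (n * q) • a := by
    intro n q a ha
    induction n with
    | zero => simp
    | succ n ih =>
      rw [pow_succ', Module.End.mul_apply, ih, map_smul, ha, smul_smul, ← pow_add]
      congr 2
      ring
  refine hX.weight_parity_induction (P := fun a => X.ope (-1) 0 g (X.ope r s a b) =
      X.ope r s (X.ope (-1) 0 g a) b + X.ope r s ((X.fermion ^ p) a) (X.ope (-1) 0 g b))
    (fun ha ka q a haW haF => ?_) (fun v w hv hw => ?_) a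
  · refine hX.weight_induction (P := fun b => X.ope (-1) 0 g (X.ope r s a b) =
      X.ope r s (X.ope (-1) 0 g a) b + X.ope r s ((X.fermion ^ p) a) (X.ope (-1) 0 g b))
      (fun hb kb b hbW => ?_) (fun v w hv hw => ?_) b
    · refine hX.ext_form_weight fun hv kv v hvW => ?_
      rw [hX.form_residue_ope hgW hol hgF haF haW hbW hvW, hpow p q a haF]
      simp
    · simp only [map_add, hv, hw]
      abel
  · simp only [map_add, LinearMap.add_apply, hv, hw]
    abel

theorem residue_ope_even {g : H} {hg : ℝ} (hgW : g ∈ X.weightSpace hg 0)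
    (hol : X.IsHolomorphic g) (hgF : X.fermion g = g) (r s : ℝ) (a b : H) :
    X.ope (-1) 0 g (X.ope r s a b) =
      X.ope r s (X.ope (-1) 0 g a) b + X.ope r s a (X.ope (-1) 0 g b) := by
  simpa using hX.residue_ope (p := 0) hgW hol (by simpa using hgF) r s a b

theorem residue_ope_odd {g : H} {hg : ℝ} (hgW : g ∈ X.weightSpace hg 0)
    (hol : X.IsHolomorphic g) (hgF : X.fermion g = -g) (r s : ℝ) (a b : H) :
    X.ope (-1) 0 g (X.ope r s a b) =
      X.ope r s (X.ope (-1) 0 g a) b + X.ope r s (X.fermion a) (X.ope (-1) 0 g b) := by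
  simpa using hX.residue_ope (p := 1) hgW hol (by simpa using hgF) r s a b

theorem L_zero_ope (r s : ℝ) (a b : H) :
    X.L 0 (X.ope r s a b) = X.ope r s (X.L 0 a) b + X.ope r s a (X.L 0 b) +
      (r : ℂ) • X.ope r s a b := by
  refine hX.weight_induction (P := fun a => X.L 0 (X.ope r s a b) = X.ope r s (X.L 0 a) b +
    X.ope r s a (X.L 0 b) + (r : ℂ) • X.ope r s a b) (fun ha ka a haW => ?_) (fun v w hv hw => ?_) a
  · refine hX.weight_induction (P := fun b => X.L 0 (X.ope r s a b) = X.ope r s (X.L 0 a) b +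
      X.ope r s a (X.L 0 b) + (r : ℂ) • X.ope r s a b) (fun hb kb b hbW => ?_)
      (fun v w hv hw => ?_) b
    · rw [(mem_weightSpace.1 (hX.ope_weight r s _ _ _ _ _ _ haW hbW)).1,
        (mem_weightSpace.1 haW).1, (mem_weightSpace.1 hbW).1]
      simp only [map_smul, LinearMap.smul_apply]
      push_cast
      module
    · simp only [map_add, hv, hw]
      module
  · simp only [map_add, LinearMap.add_apply, hv, hw]
    module

end IsCFT

/-! ### Exchange of the two sectors -/

/-- The theory in the complex conjugate coordinate, with the two sectors exchanged. -/
def mirror (X : CFTData H) : CFTData H where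
  vac := X.vac
  fermion := X.fermion
  ope r s := X.ope s r
  form := X.form
  T := X.Tbar
  Tbar := X.T
  c := X.cbar
  cbar := X.c

theorem mirror_weightSpace (h k : ℝ) : X.mirror.weightSpace h k = X.weightSpace k h :=
  inf_comm _ _

theorem IsCorrelator.mirror (hX : X.IsCFT) {ε : ℂ} {v a b d : H} {F : ℂ → ℂ → ℂ}
    (hF : X.IsCorrelator ε v a b d F) :
    X.mirror.IsCorrelator ε v a b d
      (fun z w => F (starRingEnd ℂ z) (starRingEnd ℂ w)) := by
  let e : (ℝ × ℝ) × (ℝ × ℝ) ≃ (ℝ × ℝ) × (ℝ × ℝ) :=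
    (Equiv.prodComm ℝ ℝ).prodCongr (Equiv.prodComm ℝ ℝ)
  have key : ∀ (r s r' s' : ℝ) (z w : ℂ) (x y : H) (t : H), X.ope s r x y ≠ 0 ∨ t = 0 →
      (∃ n : ℤ, s' - r' = n) ∨ t = 0 →
      zPow s r (starRingEnd ℂ z) * zPow s' r' (starRingEnd ℂ w) * X.form v t =
        zPow r s z * zPow r' s' w * X.form v t := by
    intro r s r' s' z w x y t h1 h2
    rcases h1 with h1 | rfl
    · rcases h2 with h2 | rfl
      · rw [zPow_conj (hX.ope_int _ _ _ _ h1), zPow_conj h2]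
      · simp
    · simp
  have hint : ∀ (r s : ℝ) (x y t : H), (X.ope s r x y = 0 → t = 0) →
      (∃ n : ℤ, s - r = n) ∨ t = 0 := fun r s x y t h => by
    by_cases h0 : X.ope s r x y = 0
    · exact .inr (h h0)
    · exact .inl (hX.ope_int _ _ _ _ h0)
  have hne : ∀ z w : ℂ, ‖starRingEnd ℂ z - starRingEnd ℂ w‖ = ‖z - w‖ := fun z w => by
    rw [← map_sub, Complex.norm_conj]
  refine ⟨?_, fun z w h0 h1 => ?_, fun z w h0 h1 => ?_, fun z w h0 h1 => ?_⟩
  · intro p hp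
    have hconj : AnalyticAt ℝ
        (fun p : ℂ × ℂ => (starRingEnd ℂ p.1, starRingEnd ℂ p.2)) p :=
      ((Complex.conjCLE.toContinuousLinearMap.analyticAt _).comp analyticAt_fst).prod
        ((Complex.conjCLE.toContinuousLinearMap.analyticAt _).comp analyticAt_snd)
    refine AnalyticAt.comp (g := fun p : ℂ × ℂ => F p.1 p.2)
      (f := fun p : ℂ × ℂ => (starRingEnd ℂ p.1, starRingEnd ℂ p.2)) (x := p)
      (hF.analytic (starRingEnd ℂ p.1, starRingEnd ℂ p.2) ?_) hconj
    exact ⟨by simpa using hp.1, by simpa using hp.2.1, fun h => hp.2.2 (star_injective h)⟩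
  · refine (e.hasSum_iff.2 (hF.ordered (starRingEnd ℂ z) (starRingEnd ℂ w) (by simpa using h0)
      (by simpa using h1))).congr_fun ?_
    rintro ⟨⟨r, s⟩, ⟨r', s'⟩⟩
    refine (key r s r' s' z w a (X.ope s' r' b d) (X.ope s r a (X.ope s' r' b d)) ?_
      (hint _ _ b d _ fun h => by rw [h, map_zero])).symm
    exact (em (X.ope s r a (X.ope s' r' b d) = 0)).symm
  · refine (e.hasSum_iff.2 (hF.swapped (starRingEnd ℂ z) (starRingEnd ℂ w) (by simpa using h0)
      (by simpa using h1))).congr_fun ?_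
    rintro ⟨⟨r, s⟩, ⟨r', s'⟩⟩
    refine congrArg (ε * ·) (key r s r' s' w z b (X.ope s' r' a d) _ ?_
      (hint _ _ a d (X.ope s r b (X.ope s' r' a d)) fun h => by rw [h, map_zero])).symm
    exact (em (X.ope s r b (X.ope s' r' a d) = 0)).symm
  · refine (e.hasSum_iff.2 (hF.fused (starRingEnd ℂ z) (starRingEnd ℂ w) (by simpa [hne] using h0)
      (by simpa [hne] using h1))).congr_fun ?_
    rintro ⟨⟨r, s⟩, ⟨r', s'⟩⟩
    have := (key r s r' s' w (z - w) (X.ope s' r' a b) d _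
      (em (X.ope s r (X.ope s' r' a b) d = 0)).symm (hint _ _ a b _ fun h => by simp [h])).symm
    rwa [map_sub] at this

theorem IsCFT.mirror (hX : X.IsCFT) : X.mirror.IsCFT where
  fermion_sq := hX.fermion_sq
  fermion_ope r s := hX.fermion_ope s r
  fermion_vac := hX.fermion_vac
  fermion_T := hX.fermion_Tbar
  fermion_Tbar := hX.fermion_T
  ope_int r s a b h := by
    obtain ⟨n, hn⟩ := hX.ope_int s r a b h
    exact ⟨-n, by push_cast; linarith⟩
  ope_weight r s h₁ k₁ h₂ k₂ a b ha hb := by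
    rw [mirror_weightSpace] at *
    exact hX.ope_weight s r _ _ _ _ a b ha hb
  iSup_weightSpace := by
    simp_rw [mirror_weightSpace]
    exact ((Equiv.prodComm ℝ ℝ).iSup_comp
      (g := fun p : ℝ × ℝ => X.weightSpace p.1 p.2)).trans hX.iSup_weightSpace
  energy_bddBelow := by
    obtain ⟨E, hE⟩ := hX.energy_bddBelow
    exact ⟨E, fun h k hne => by rw [add_comm]; exact hE k h (by rwa [mirror_weightSpace] at hne)⟩
  vac_ope r s b := by
    simp only [CFTData.mirror, hX.vac_ope, and_comm]
  ope_vac r s a h := by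
    obtain ⟨m, n, hm, hn⟩ := hX.ope_vac s r a h
    exact ⟨n, m, hn, hm⟩
  ope_vac_zero := hX.ope_vac_zero
  T_mem := by rw [mirror_weightSpace]; exact hX.Tbar_mem
  Tbar_mem := by rw [mirror_weightSpace]; exact hX.T_mem
  T_holomorphic := fun r s h => hX.Tbar_antiholomorphic s r h
  Tbar_antiholomorphic := fun r s h => hX.T_holomorphic s r h
  virasoro := hX.virasoro_bar
  virasoro_bar := hX.virasoro
  commute m n := (hX.commute n m).symm
  translation r s := hX.translation_bar s r
  translation_bar r s := hX.translation s r
  form_symm := hX.form_symm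
  form_nondeg := hX.form_nondeg
  form_orthogonal h₁ k₁ h₂ k₂ v w hv hw hne := by
    rw [mirror_weightSpace] at hv hw
    refine hX.form_orthogonal _ _ _ _ v w hv hw fun h => hne ?_
    rw [Prod.mk.injEq] at h ⊢
    exact h.symm
  correlator p q v a b d ha hb := by
    obtain ⟨F, hF⟩ := hX.correlator p q v a b d ha hb
    exact ⟨_, hF.mirror hX⟩

theorem IsUnitary.mirror (hU : X.IsUnitary) : X.mirror.IsUnitary :=
  ⟨hU.pos, hU.Lbar_adj, hU.L_adj⟩

theorem IsN2Bar.mirror {N : N2Currents H} (hN : X.IsN2Bar N) : X.mirror.IsN2 N where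
  mem := by simpa only [mirror_weightSpace] using hN.mem
  parity := hN.parity
  holomorphic := ⟨fun r s h => hN.antiholomorphic.1 s r h,
    fun r s h => hN.antiholomorphic.2.1 s r h, fun r s h => hN.antiholomorphic.2.2 s r h⟩
  algebra := hN.algebra

end CFTData

/-! ### Unitary representations of the `N = 2` algebra -/

namespace N2Modes

variable {H : Type*} [AddCommGroup H] [Module ℂ H] {A : N2Modes H} {c : ℝ}
  {form : H →ₗ⋆[ℂ] H →ₗ[ℂ] ℂ}

theorem isHalfOdd_half : IsHalfOdd (1 / 2) := ⟨0, by norm_num⟩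

theorem isHalfOdd_neg_half : IsHalfOdd (-1 / 2) := ⟨-1, by norm_num⟩

theorem isHalfOdd_neg {r : ℝ} (hr : IsHalfOdd r) : IsHalfOdd (-r) := by
  obtain ⟨k, rfl⟩ := hr
  exact ⟨-k - 1, by push_cast; ring⟩

/-- The operator `2 L₀ - J₀ = {G⁺_{-1/2}, G⁻_{1/2}}`.  In a unitary theory it is nonnegative, and its
kernel consists of the chiral states whose charge is twice their weight. -/
def chiralGap (A : N2Modes H) : Module.End ℂ H := (2 : ℂ) • A.L 0 - A.J 0

theorem chiralGap_apply (v : H) : A.chiralGap v = (2 : ℂ) • A.L 0 v - A.J 0 v := rfl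

namespace IsSuperVirasoro

variable (hA : A.IsSuperVirasoro c)
include hA

theorem anticomm_adjoint {r : ℝ} (hr : IsHalfOdd r) (v : H) :
    A.Gp r (A.Gm (-r) v) + A.Gm (-r) (A.Gp r v) =
      (2 : ℂ) • A.L 0 v + (2 * r : ℂ) • A.J 0 v + ((c : ℂ) / 12 * (4 * (r : ℂ) ^ 2 - 1)) • v := by
  have h := LinearMap.congr_fun (hA.GpGm r (-r) hr (isHalfOdd_neg hr)) v
  simp only [add_neg_cancel, if_true, LinearMap.add_apply, Module.End.mul_apply,
    LinearMap.smul_apply, Module.End.one_apply] at h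
  rw [h]
  push_cast
  module

theorem chiralGap_eq (v : H) :
    A.chiralGap v = A.Gp (-1 / 2) (A.Gm (1 / 2) v) + A.Gm (1 / 2) (A.Gp (-1 / 2) v) := by
  have h := hA.anticomm_adjoint isHalfOdd_neg_half v
  rw [show -(-1 / 2 : ℝ) = 1 / 2 by norm_num] at h
  rw [h, chiralGap_apply]
  push_cast
  module

/-- On states killed by `G⁺_{-1/2}`, translations are exact. -/
theorem L_neg_one_eq {v : H} (hv : A.Gp (-1 / 2) v = 0) :
    A.L (-1) v = A.Gp (-1 / 2) ((1 / 2 : ℂ) • A.Gm (-1 / 2) v) := by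
  have h := LinearMap.congr_fun (hA.GpGm _ _ isHalfOdd_neg_half isHalfOdd_neg_half) v
  rw [show (-1 / 2 + -1 / 2 : ℝ) = -1 by norm_num] at h
  simp only [LinearMap.add_apply, Module.End.mul_apply, LinearMap.smul_apply, hv, map_zero,
    add_zero, sub_self, zero_smul, neg_eq_zero, one_ne_zero, if_false] at h
  rw [map_smul, h, smul_smul]
  norm_num

theorem chiralGap_L (n : ℤ) (v : H) :
    A.chiralGap (A.L n v) = A.L n (A.chiralGap v) + (-2 * n : ℂ) • A.L n v := by
  have h1 := LinearMap.congr_fun (hA.LL 0 n) v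
  have h2 := LinearMap.congr_fun (hA.LJ n 0) v
  simp only [Int.cast_zero, zero_add, add_zero, LinearMap.sub_apply, LinearMap.zero_apply,
    Module.End.mul_apply, LinearMap.smul_apply, mul_zero, zero_mul, ite_self, zero_smul, neg_zero,
    sub_eq_iff_eq_add, zero_sub] at h1 h2
  rw [chiralGap_apply, chiralGap_apply, map_sub, map_smul, h1, h2]
  module

theorem chiralGap_J (n : ℤ) (v : H) :
    A.chiralGap (A.J n v) = A.J n (A.chiralGap v) + (-2 * n : ℂ) • A.J n v := by
  have h1 := LinearMap.congr_fun (hA.LJ 0 n) v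
  have h2 := LinearMap.congr_fun (hA.JJ 0 n) v
  simp only [Int.cast_zero, zero_add, LinearMap.sub_apply, LinearMap.zero_apply,
    Module.End.mul_apply, LinearMap.smul_apply, mul_zero, ite_self, zero_smul,
    sub_eq_iff_eq_add] at h1 h2
  rw [chiralGap_apply, chiralGap_apply, map_sub, map_smul, h1, h2]
  module

theorem chiralGap_Gp {r : ℝ} (hr : IsHalfOdd r) (v : H) :
    A.chiralGap (A.Gp r v) = A.Gp r (A.chiralGap v) + (-2 * r - 1 : ℂ) • A.Gp r v := by
  have h1 := LinearMap.congr_fun (hA.LG 0 r hr).1 v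
  have h2 := LinearMap.congr_fun (hA.JG 0 r hr).1 v
  simp only [Int.cast_zero, zero_add, zero_div, zero_sub, LinearMap.sub_apply,
    Module.End.mul_apply, LinearMap.smul_apply, sub_eq_iff_eq_add] at h1 h2
  rw [chiralGap_apply, chiralGap_apply, map_sub, map_smul, h1, h2]
  module

theorem chiralGap_Gm {r : ℝ} (hr : IsHalfOdd r) (v : H) :
    A.chiralGap (A.Gm r v) = A.Gm r (A.chiralGap v) + (-2 * r + 1 : ℂ) • A.Gm r v := by
  have h1 := LinearMap.congr_fun (hA.LG 0 r hr).2 v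
  have h2 := LinearMap.congr_fun (hA.JG 0 r hr).2 v
  simp only [Int.cast_zero, zero_add, zero_div, zero_sub, LinearMap.sub_apply,
    Module.End.mul_apply, LinearMap.smul_apply, LinearMap.neg_apply, sub_eq_iff_eq_add] at h1 h2
  rw [chiralGap_apply, chiralGap_apply, map_sub, map_smul, h1, h2]
  module

theorem chiralGap_of_isChiralPrimary {h q : ℝ} {v : H} (hv : A.IsChiralPrimary h q v) :
    A.chiralGap v = 0 := by
  rw [hA.chiralGap_eq, hv.1.Gm_pos _ isHalfOdd_half (by norm_num), hv.2, map_zero, map_zero,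
    add_zero]

end IsSuperVirasoro

theorem form_self_re_nonneg (hpos : ∀ v, v ≠ 0 → 0 < (form v v).re) (v : H) :
    0 ≤ (form v v).re := by
  by_cases h : v = 0
  · simp [h]
  · exact (hpos v h).le

theorem eq_zero_of_form_self (hpos : ∀ v, v ≠ 0 → 0 < (form v v).re) {v : H}
    (h : form v v = 0) : v = 0 := by
  by_contra hv
  simpa [h] using hpos v hv

variable (hA : A.IsSuperVirasoro c) (hS : A.IsStar form)
include hA hS

/-- The expectation value of `{G⁺_r, G⁻_{-r}}` is a sum of two squares. -/
theorem form_anticomm {r : ℝ} (hr : IsHalfOdd r) (v : H) :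
    form (A.Gm (-r) v) (A.Gm (-r) v) + form (A.Gp r v) (A.Gp r v) =
      form v ((2 : ℂ) • A.L 0 v + (2 * r : ℂ) • A.J 0 v +
        ((c : ℂ) / 12 * (4 * (r : ℂ) ^ 2 - 1)) • v) := by
  rw [← hA.anticomm_adjoint hr, hS.Gm_adj _ _ _ (isHalfOdd_neg hr), hS.Gp_adj _ _ _ hr, neg_neg,
    map_add]

theorem form_chiralGap_self (v : H) :
    form (A.Gm (1 / 2) v) (A.Gm (1 / 2) v) + form (A.Gp (-1 / 2) v) (A.Gp (-1 / 2) v) =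
      form v (A.chiralGap v) := by
  have h := form_anticomm hA hS isHalfOdd_neg_half v
  rw [show -(-1 / 2 : ℝ) = 1 / 2 by norm_num] at h
  rw [h, chiralGap_apply]
  congr 1
  push_cast
  module

variable (hpos : ∀ v, v ≠ 0 → 0 < (form v v).re)
include hpos

theorem chiralGap_eigenvalue_nonneg {t : ℝ} {v : H} (hv : v ≠ 0)
    (h : A.chiralGap v = (t : ℂ) • v) : 0 ≤ t := by
  have h1 := congrArg Complex.re (form_chiralGap_self hA hS v)
  rw [h, map_smul, smul_eq_mul, Complex.re_ofReal_mul, Complex.add_re] at h1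
  have h2 := form_self_re_nonneg hpos (A.Gm (1 / 2) v)
  have h3 := form_self_re_nonneg hpos (A.Gp (-1 / 2) v)
  have h4 := hpos v hv
  by_contra hneg
  nlinarith

theorem eq_zero_of_chiralGap_neg {t : ℝ} {v : H} (h : A.chiralGap v = (t : ℂ) • v) (ht : t < 0) :
    v = 0 := by
  by_contra hv
  exact ht.not_ge (chiralGap_eigenvalue_nonneg hA hS hpos hv h)

theorem annihilated_of_chiralGap {v : H} (h : A.chiralGap v = 0) :
    A.Gp (-1 / 2) v = 0 ∧ A.Gm (1 / 2) v = 0 := by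
  have h1 := congrArg Complex.re (form_chiralGap_self hA hS v)
  rw [h, map_zero, Complex.add_re, Complex.zero_re] at h1
  have h2 := form_self_re_nonneg hpos (A.Gm (1 / 2) v)
  have h3 := form_self_re_nonneg hpos (A.Gp (-1 / 2) v)
  constructor
  · by_contra hne
    linarith [hpos _ hne]
  · by_contra hne
    linarith [hpos _ hne]

/-- Eigenstates of `L₀` and `J₀` with `2 h = q` are chiral primaries: the positive modes would
lower the nonnegative operator `2 L₀ - J₀` below zero, except for `G⁻_{1/2}`, which vanishes by
`annihilated_of_chiralGap`. -/
theorem isChiralPrimary_of_chiralGap {h q : ℝ} {v : H} (hL : A.L 0 v = (h : ℂ) • v)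
    (hJ : A.J 0 v = (q : ℂ) • v) (hv : A.chiralGap v = 0) : A.IsChiralPrimary h q v := by
  obtain ⟨hGp, hGm⟩ := annihilated_of_chiralGap hA hS hpos hv
  refine ⟨⟨hL, hJ, fun n hn => ?_, fun n hn => ?_, fun r hr h0 => ?_, fun r hr h0 => ?_⟩, hGp⟩
  · refine eq_zero_of_chiralGap_neg hA hS hpos (t := -2 * n) ?_ ?_
    · rw [hA.chiralGap_L, hv, map_zero, zero_add]
      push_cast
      rfl
    · have : (0 : ℝ) < n := by exact_mod_cast hn
      linarith
  · refine eq_zero_of_chiralGap_neg hA hS hpos (t := -2 * n) ?_ ?_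
    · rw [hA.chiralGap_J, hv, map_zero, zero_add]
      push_cast
      rfl
    · have : (0 : ℝ) < n := by exact_mod_cast hn
      linarith
  · refine eq_zero_of_chiralGap_neg hA hS hpos (t := -2 * r - 1) ?_ (by linarith)
    rw [hA.chiralGap_Gp hr, hv, map_zero, zero_add]
    push_cast
    rfl
  · by_cases hr' : r = 1 / 2
    · rw [hr', hGm]
    refine eq_zero_of_chiralGap_neg hA hS hpos (t := -2 * r + 1) ?_ ?_
    · rw [hA.chiralGap_Gm hr, hv, map_zero, zero_add]
      push_cast
      rfl
    · obtain ⟨k, rfl⟩ := hr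
      have hk : (0 : ℤ) < k := by
        have h1 : (-1 : ℤ) < k := by
          have : (-1 : ℝ) < k := by linarith
          exact_mod_cast this
        have h2 : k ≠ 0 := by
          rintro rfl
          simp at hr'
        omega
      have : (0 : ℝ) < k := by exact_mod_cast hk
      linarith

/-- The bounds follow from `⟨v | {G⁺_r, G⁻_{-r}} | v⟩ ≥ 0` for `r = 1/2` and `r = -3/2`. -/
theorem IsChiralPrimary.weight_bounds {h q : ℝ} {v : H} (hv0 : v ≠ 0)
    (hv : A.IsChiralPrimary h q v) : 0 ≤ h ∧ h ≤ c / 6 := by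
  have hq : q = 2 * h := by
    have h1 := hA.chiralGap_of_isChiralPrimary hv
    rw [chiralGap_apply, hv.1.weight, hv.1.charge, smul_smul, ← sub_smul, smul_eq_zero] at h1
    have h2 := h1.resolve_right hv0
    have h3 : (2 * h - q : ℝ) = 0 := by exact_mod_cast h2
    linarith
  have key : ∀ r : ℝ, IsHalfOdd r → 0 ≤ 2 * h + 2 * r * q + c / 12 * (4 * r ^ 2 - 1) := by
    intro r hr
    have h1 := congrArg Complex.re (form_anticomm hA hS hr v)
    rw [hv.1.weight, hv.1.charge, smul_smul, smul_smul, ← add_smul, ← add_smul, map_smul,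
      smul_eq_mul, Complex.add_re] at h1
    have h2 : (2 * h + 2 * r * q + (c : ℂ) / 12 * (4 * (r : ℂ) ^ 2 - 1) : ℂ) =
        ((2 * h + 2 * r * q + c / 12 * (4 * r ^ 2 - 1) : ℝ) : ℂ) := by push_cast; ring
    rw [h2, Complex.re_ofReal_mul] at h1
    have h3 := form_self_re_nonneg hpos (A.Gm (-r) v)
    have h4 := form_self_re_nonneg hpos (A.Gp r v)
    have h5 := hpos v hv0
    by_contra hneg
    nlinarith
  have k1 := key (1 / 2) isHalfOdd_half
  have k2 := key (-3 / 2) ⟨-2, by norm_num⟩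
  rw [hq] at k1 k2
  constructor <;> linarith

end N2Modes

namespace CFTData

variable {H : Type*} [AddCommGroup H] [Module ℂ H] {X : CFTData H}

/-! ### Holomorphic operators in a unitary theory -/

namespace IsCFT

variable (hX : X.IsCFT)
include hX

theorem Lbar_mem {h k : ℝ} {v : H} (hv : v ∈ X.weightSpace h k) (n : ℝ) :
    X.Lbar n v ∈ X.weightSpace h (k - n) := by
  have h1 := hX.ope_weight 0 (-n - 2) _ _ _ _ _ _ hX.Tbar_mem hv
  rwa [show 0 + h + 0 = h by ring, show 2 + k + (-n - 2) = k - n by ring] at h1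

theorem Lbar_zero_ope (r s : ℝ) (a b : H) :
    X.Lbar 0 (X.ope r s a b) = X.ope r s (X.Lbar 0 a) b + X.ope r s a (X.Lbar 0 b) +
      (s : ℂ) • X.ope r s a b :=
  hX.mirror.L_zero_ope s r a b

theorem exists_weight_decomposition (v : H) : ∃ f : ℝ × ℝ →₀ H,
    (∀ p, f p ∈ X.weightSpace p.1 p.2) ∧ ∑ p ∈ f.support, f p = v := by
  have hv : v ∈ ⨆ p : ℝ × ℝ, X.weightSpace p.1 p.2 := by
    rw [hX.iSup_weightSpace]
    trivial
  exact (Submodule.mem_iSup_iff_exists_finsupp _ _).1 hv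

variable (hU : X.IsUnitary)
include hU

/-- An operator that shifts weights by a fixed amount and kills `v` kills every weight component of
`v`, since the images of the components are orthogonal. -/
theorem apply_component_eq_zero {f : ℝ × ℝ →₀ H} (hf : ∀ p, f p ∈ X.weightSpace p.1 p.2)
    {S : Module.End ℂ H} {t u : ℝ}
    (hS : ∀ h k, ∀ v ∈ X.weightSpace h k, S v ∈ X.weightSpace (h + t) (k + u))
    (h0 : S (∑ p ∈ f.support, f p) = 0) (p : ℝ × ℝ) : S (f p) = 0 := by
  refine N2Modes.eq_zero_of_form_self hU.pos ?_
  have h1 : X.form (S (f p)) (S (∑ p ∈ f.support, f p)) = X.form (S (f p)) (S (f p)) := by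
    rw [map_sum, map_sum]
    refine Finset.sum_eq_single p (fun q _ hq => ?_) fun hp => ?_
    · refine hX.form_orthogonal _ _ _ _ _ _ (hS _ _ _ (hf p)) (hS _ _ _ (hf q)) fun he => hq ?_
      rw [Prod.mk.injEq] at he
      exact Prod.ext (by linarith [he.1]) (by linarith [he.2])
    · rw [Finsupp.notMem_support_iff.1 hp]
      simp
  rw [← h1, h0, map_zero]

theorem form_Lbar_neg_one (v : H) : X.form (X.Lbar (-1) v) (X.Lbar (-1) v) =
    2 * X.form v (X.Lbar 0 v) + X.form (X.Lbar 1 v) (X.Lbar 1 v) := by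
  have h1 := hU.Lbar_adj (-1) v (X.Lbar (-1) v)
  have h2 := hU.Lbar_adj 1 v (X.Lbar 1 v)
  have h3 := LinearMap.congr_fun (hX.virasoro_bar 1 (-1)) v
  norm_num [sub_eq_iff_eq_add] at h1 h2 h3
  rw [h1, h2, h3]
  simp

/-- Descending with `L̄₁` from a state of negative weight would never end, because
`‖L̄₋₁ v‖² = 2 k ‖v‖² < 0` is impossible, and so would violate the lower bound on the energy. -/
theorem weight_bar_nonneg {h k : ℝ} {v : H} (hv : v ∈ X.weightSpace h k) (h0 : v ≠ 0) :
    0 ≤ k := by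
  by_contra! hk
  obtain ⟨E, hE⟩ := hX.energy_bddBelow
  have step : ∀ n : ℕ, ∃ w ∈ X.weightSpace h (k - n), w ≠ 0 := by
    intro n
    induction n with
    | zero => exact ⟨v, by simpa using hv, h0⟩
    | succ n ih =>
      obtain ⟨w, hw, hw0⟩ := ih
      refine ⟨X.Lbar 1 w, ?_, fun h1 => ?_⟩
      · convert hX.Lbar_mem hw 1 using 2
        push_cast
        ring
      · have h2 := congrArg Complex.re (hX.form_Lbar_neg_one hU w)
        have h3 : (2 : ℂ) * ((k - n : ℝ) * X.form w w) = (2 * (k - n) : ℝ) * X.form w w := by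
          push_cast
          ring
        rw [h1, (mem_weightSpace.1 hw).2, map_smul, smul_eq_mul, map_zero, add_zero, h3,
          Complex.re_ofReal_mul] at h2
        have h4 := N2Modes.form_self_re_nonneg hU.pos (X.Lbar (-1) w)
        have h5 := hU.pos w hw0
        have h6 : (0 : ℝ) ≤ n := Nat.cast_nonneg n
        nlinarith
  obtain ⟨n, hn⟩ := exists_nat_gt (h + k - E)
  obtain ⟨w, hw, hw0⟩ := step n
  have := hE _ _ fun hbot => hw0 ((Submodule.eq_bot_iff _).1 hbot w hw)
  linarith

omit hU in
theorem isHolomorphic_iff_Lbar_neg_one {v : H} : X.IsHolomorphic v ↔ X.Lbar (-1) v = 0 := by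
  constructor
  · intro h
    rw [← hX.ope_vac_zero (X.Lbar (-1) v), hX.translation_bar, h _ _ (by norm_num)]
    simp
  · intro h r s hs
    refine LinearMap.ext fun b => ?_
    have h1 := hX.translation_bar r (s - 1) v b
    rw [h, sub_add_cancel, map_zero, LinearMap.zero_apply, eq_comm, smul_eq_zero] at h1
    exact h1.resolve_left (by exact_mod_cast hs)

/-- By `‖L̄₋₁ v‖² = 2 k ‖v‖² + ‖L̄₁ v‖²` with `k ≥ 0`, translation invariance in `z̄` amounts to
`k = 0` on every weight component. -/
theorem isHolomorphic_iff {v : H} : X.IsHolomorphic v ↔ X.Lbar 0 v = 0 := by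
  rw [hX.isHolomorphic_iff_Lbar_neg_one]
  obtain ⟨f, hf, rfl⟩ := hX.exists_weight_decomposition v
  have key : ∀ p, X.form (X.Lbar (-1) (f p)) (X.Lbar (-1) (f p)) =
      2 * (p.2 * X.form (f p) (f p)) + X.form (X.Lbar 1 (f p)) (X.Lbar 1 (f p)) := by
    intro p
    rw [hX.form_Lbar_neg_one hU, (mem_weightSpace.1 (hf p)).2, map_smul, smul_eq_mul]
  constructor
  · intro h
    rw [map_sum]
    refine Finset.sum_eq_zero fun p hp => ?_
    have h1 := hX.apply_component_eq_zero hU hf (S := X.Lbar (-1)) (t := 0) (u := 1)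
      (fun h k v hv => by simpa using hX.Lbar_mem hv (-1)) h p
    have h2 := congrArg Complex.re (key p)
    have h3 : (2 : ℂ) * (p.2 * X.form (f p) (f p)) = (2 * p.2 : ℝ) * X.form (f p) (f p) := by
      push_cast
      ring
    rw [h1, map_zero, h3, Complex.add_re, Complex.re_ofReal_mul, Complex.zero_re] at h2
    have h4 := N2Modes.form_self_re_nonneg hU.pos (X.Lbar 1 (f p))
    have h5 := hU.pos (f p) (Finsupp.mem_support_iff.1 hp)
    have h6 := hX.weight_bar_nonneg hU (hf p) (Finsupp.mem_support_iff.1 hp)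
    have h7 : p.2 = 0 := by
      by_contra hne
      have := lt_of_le_of_ne h6 (Ne.symm hne)
      nlinarith
    rw [(mem_weightSpace.1 (hf p)).2, h7]
    simp
  · intro h
    rw [map_sum]
    refine Finset.sum_eq_zero fun p hp => ?_
    have h1 := hX.apply_component_eq_zero hU hf (S := X.Lbar 0) (t := 0) (u := 0)
      (fun h k v hv => by simpa using hX.Lbar_mem hv 0) h p
    have hp0 := Finsupp.mem_support_iff.1 hp
    have hp2 : p.2 = 0 := by
      rw [(mem_weightSpace.1 (hf p)).2, smul_eq_zero] at h1
      exact_mod_cast h1.resolve_right hp0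
    have h2 : X.Lbar 1 (f p) = 0 := by
      by_contra hne
      have := hX.weight_bar_nonneg hU (hX.Lbar_mem (hf p) 1) hne
      linarith
    refine N2Modes.eq_zero_of_form_self hU.pos ?_
    rw [key, h2, hp2]
    simp

end IsCFT

/-! ### Operator products at the same point -/

namespace IsCFT

variable (hX : X.IsCFT)
include hX

/-- Only finitely many terms contribute to a matrix element of an operator product. -/
theorem finite_support_form_ope (v a b : H) :
    {p : ℝ × ℝ | X.form v (X.ope p.1 p.2 a b) ≠ 0}.Finite := by
  refine hX.weight_induction
    (P := fun v => {p : ℝ × ℝ | X.form v (X.ope p.1 p.2 a b) ≠ 0}.Finite)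
    (fun hv kv v hvW => ?_) (fun v w h1 h2 => (h1.union h2).subset fun p hp => ?_) v
  · refine hX.weight_induction
      (P := fun a => {p : ℝ × ℝ | X.form v (X.ope p.1 p.2 a b) ≠ 0}.Finite)
      (fun ha ka a haW => ?_) (fun x y h1 h2 => (h1.union h2).subset fun p hp => ?_) a
    · refine hX.weight_induction
        (P := fun b => {p : ℝ × ℝ | X.form v (X.ope p.1 p.2 a b) ≠ 0}.Finite)
        (fun hb kb b hbW => ?_) (fun x y h1 h2 => (h1.union h2).subset fun p hp => ?_) b
      · refine (Set.finite_singleton (hv - ha - hb, kv - ka - kb)).subset fun p hp => ?_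
        obtain ⟨h1, h2⟩ := hX.weight_eq_of_form_ne_zero hvW
          (hX.ope_weight _ _ _ _ _ _ _ _ haW hbW) hp
        exact Prod.ext (by simp only; linarith) (by simp only; linarith)
      · by_contra hcon
        simp only [Set.mem_union, Set.mem_ofPred_eq, not_or, not_not] at hcon
        exact hp (by simp [hcon.1, hcon.2])
    · by_contra hcon
      simp only [Set.mem_union, Set.mem_ofPred_eq, not_or, not_not] at hcon
      exact hp (by simp [hcon.1, hcon.2])
  · by_contra hcon
    simp only [Set.mem_union, Set.mem_ofPred_eq, not_or, not_not] at hcon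
    exact hp (by simp [hcon.1, hcon.2])

theorem isProductAtPoint_of_nonsingular {a b : H}
    (h : ∀ r s, X.ope r s a b ≠ 0 → 0 ≤ r ∧ 0 ≤ s) : X.IsProductAtPoint a b (X.ope 0 0 a b) := by
  intro v
  have hfin := hX.finite_support_form_ope v a b
  refine ⟨fun z => ∑ p ∈ hfin.toFinset, zPow p.1 p.2 z * X.form v (X.ope p.1 p.2 a b),
    fun z _ => hasSum_sum_of_ne_finset_zero fun p hp => ?_, ?_⟩
  · simp only [Set.Finite.mem_toFinset, Set.mem_ofPred_eq, not_not] at hp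
    rw [hp, mul_zero]
  have hlim : X.form v (X.ope 0 0 a b) = ∑ p ∈ hfin.toFinset,
      (if p = (0, 0) then 1 else 0) * X.form v (X.ope p.1 p.2 a b) := by
    rw [Finset.sum_eq_single (0, 0)]
    · simp
    · intro p _ hp
      simp [hp]
    · intro hp
      simp only [Set.Finite.mem_toFinset, Set.mem_ofPred_eq, not_not] at hp
      simp [hp]
  rw [hlim]
  refine tendsto_finsetSum _ fun p hp => Tendsto.mul_const _ ?_
  have hne : X.ope p.1 p.2 a b ≠ 0 := fun h0 => by
    simp [h0] at hp
  obtain ⟨h1, h2⟩ := h _ _ hne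
  split_ifs with hp0
  · subst hp0
    exact tendsto_const_nhds.congr fun z => (zPow_zero_zero z).symm
  · have hpos : 0 < p.1 + p.2 := by
      refine (add_nonneg h1 h2).lt_of_ne fun h3 => hp0 (Prod.ext ?_ ?_) <;> simp only <;> linarith
    rw [tendsto_zero_iff_norm_tendsto_zero]
    simp only [norm_zPow]
    have hc : ContinuousAt (fun z : ℂ => ‖z‖ ^ (p.1 + p.2)) 0 :=
      continuous_norm.continuousAt.rpow_const (.inr hpos.le)
    have ht := hc.tendsto
    rw [norm_zero, Real.zero_rpow hpos.ne'] at ht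
    exact ht.mono_left nhdsWithin_le_nhds

/-- If, within a space of operators, all position dependent terms of the three-fold products have
vanishing matrix elements, then the correlation functions are constant.  Comparing their expansions
for `|z| > |w|` and for `|z - w| < |w|`, whose domains overlap, gives associativity. -/
theorem isPointRing_of_topological (hU : X.IsUnitary) {R : Submodule ℂ H} (vac : X.vac ∈ R)
    (ferm : ∀ a ∈ R, X.fermion a ∈ R) (mul : ∀ a ∈ R, ∀ b ∈ R, X.ope 0 0 a b ∈ R)
    (nonsing : ∀ a ∈ R, ∀ b ∈ R, ∀ r s : ℝ, X.ope r s a b ≠ 0 → 0 ≤ r ∧ 0 ≤ s)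
    (ordered : ∀ v ∈ R, ∀ a ∈ R, ∀ b ∈ R, ∀ d ∈ R, ∀ r s r' s' : ℝ,
      X.form v (X.ope r s a (X.ope r' s' b d)) ≠ 0 → (r = 0 ∧ s = 0) ∧ r' = 0 ∧ s' = 0)
    (fused : ∀ v ∈ R, ∀ a ∈ R, ∀ b ∈ R, ∀ d ∈ R, ∀ r s r' s' : ℝ,
      X.form v (X.ope r s (X.ope r' s' a b) d) ≠ 0 → (r = 0 ∧ s = 0) ∧ r' = 0 ∧ s' = 0) :
    X.IsPointRing R := by
  have assoc : ∀ a ∈ R, ∀ b ∈ R, ∀ d ∈ R,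
      X.ope 0 0 (X.ope 0 0 a b) d = X.ope 0 0 a (X.ope 0 0 b d) := by
    intro a ha b hb d hd
    suffices hform : ∀ v ∈ R, X.form v (X.ope 0 0 (X.ope 0 0 a b) d) =
        X.form v (X.ope 0 0 a (X.ope 0 0 b d)) by
      refine sub_eq_zero.1 (N2Modes.eq_zero_of_form_self hU.pos ?_)
      rw [map_sub, hform, sub_self]
      exact sub_mem (mul _ (mul _ ha _ hb) _ hd) (mul _ ha _ (mul _ hb _ hd))
    intro v hv
    refine hX.parity_induction ferm (P := fun a => X.form v (X.ope 0 0 (X.ope 0 0 a b) d) =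
      X.form v (X.ope 0 0 a (X.ope 0 0 b d))) (fun p a ha haF => ?_) (fun x y h1 h2 => ?_) ha
    swap
    · simp only [map_add, LinearMap.add_apply, h1, h2]
    refine hX.parity_induction ferm (P := fun b => X.form v (X.ope 0 0 (X.ope 0 0 a b) d) =
      X.form v (X.ope 0 0 a (X.ope 0 0 b d))) (fun q b hb hbF => ?_) (fun x y h1 h2 => ?_) hb
    swap
    · simp only [map_add, LinearMap.add_apply, h1, h2]
    obtain ⟨F, hF⟩ := hX.correlator p q v a b d haF hbF
    -- the point `z = 3/2`, `w = 1` lies in both domains of convergence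
    have h1 := hF.ordered (3 / 2) 1 (by norm_num) (by norm_num)
    have h2 := hF.fused (3 / 2) 1 (by norm_num) (by norm_num)
    have e1 := h1.unique (hasSum_single ((0, 0), (0, 0)) fun i hi => by
      by_contra hne
      obtain ⟨⟨hr, hs⟩, hr', hs'⟩ := ordered v hv a ha b hb d hd _ _ _ _ (right_ne_zero_of_mul hne)
      exact hi (Prod.ext (Prod.ext hr hs) (Prod.ext hr' hs')))
    have e2 := h2.unique (hasSum_single ((0, 0), (0, 0)) fun i hi => by
      by_contra hne
      obtain ⟨⟨hr, hs⟩, hr', hs'⟩ := fused v hv a ha b hb d hd _ _ _ _ (right_ne_zero_of_mul hne)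
      exact hi (Prod.ext (Prod.ext hr hs) (Prod.ext hr' hs')))
    simpa [zPow_zero_zero] using e2.symm.trans e1
  refine ⟨nonsing, LinearMap.mk₂ ℂ (fun a b : R => (⟨X.ope 0 0 a b, mul _ a.2 _ b.2⟩ : R))
    (fun a a' b => Subtype.ext (by simp)) (fun c a b => Subtype.ext (by simp))
    (fun a b b' => Subtype.ext (by simp)) (fun c a b => Subtype.ext (by simp)),
    fun a b => hX.isProductAtPoint_of_nonsingular (nonsing _ a.2 _ b.2),
    fun a b d => Subtype.ext (assoc _ a.2 _ b.2 _ d.2), ⟨X.vac, vac⟩, rfl,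
    fun a => ⟨Subtype.ext ?_, Subtype.ext ?_⟩⟩
  · simp [hX.vac_ope]
  · simp [hX.ope_vac_zero]

end IsCFT

theorem IsNondegenerate.finiteDimensional_span (hnd : X.IsNondegenerate) {S : Set H} (M : ℝ)
    (h : ∀ v ∈ S, v ≠ 0 → ∃ E : ℝ, |E| ≤ M ∧ X.hamiltonian v = (E : ℂ) • v) :
    FiniteDimensional ℂ (Submodule.span ℂ S) := by
  have hfin := hnd.discrete M
  have := hnd.multiplicity
  refine Submodule.finiteDimensional_of_le
    (S₂ := hfin.toFinset.sup fun E : ℝ => X.hamiltonian.eigenspace (E : ℂ)) ?_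
  rw [Submodule.span_le]
  intro v hv
  by_cases h0 : v = 0
  · rw [h0]
    exact Submodule.zero_mem _
  obtain ⟨E, hE, hvE⟩ := h v hv h0
  have hmem : v ∈ X.hamiltonian.eigenspace (E : ℂ) := Module.End.mem_eigenspace_iff.2 hvE
  have hval : X.hamiltonian.HasEigenvalue (E : ℂ) :=
    Module.End.hasEigenvalue_of_hasEigenvector ⟨hmem, h0⟩
  exact (Finset.le_sup (f := fun E : ℝ => X.hamiltonian.eigenspace (E : ℂ))
    (hfin.mem_toFinset.2 ⟨hE, hval⟩)) hmem

end CFTData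

namespace CFTData

variable {H : Type*} [AddCommGroup H] [Module ℂ H] {X : CFTData H} {N N' : N2Currents H}

/-! ### Operator products of chiral states -/

theorem modes_J_zero : (X.modes N).J 0 = X.ope (-1) 0 N.j := by
  simp [modes, mode]

theorem modes_Gp_neg_half : (X.modes N).Gp (-1 / 2) = X.ope (-1) 0 N.gp := by
  simp only [modes, mode]
  norm_num

namespace IsN2

variable (hX : X.IsCFT) (hN : X.IsN2 N)
include hX hN

theorem J_zero_ope (r s : ℝ) (a b : H) : (X.modes N).J 0 (X.ope r s a b) =
    X.ope r s ((X.modes N).J 0 a) b + X.ope r s a ((X.modes N).J 0 b) := by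
  rw [modes_J_zero]
  exact hX.residue_ope_even hN.mem.1 hN.holomorphic.1 hN.parity.1 r s a b

theorem Gp_ope (r s : ℝ) (a b : H) : (X.modes N).Gp (-1 / 2) (X.ope r s a b) =
    X.ope r s ((X.modes N).Gp (-1 / 2) a) b +
      X.ope r s (X.fermion a) ((X.modes N).Gp (-1 / 2) b) := by
  rw [modes_Gp_neg_half]
  exact hX.residue_ope_odd hN.mem.2.1 hN.holomorphic.2.1 hN.parity.2.1 r s a b

theorem chiralGap_ope (r s : ℝ) (a b : H) : (X.modes N).chiralGap (X.ope r s a b) =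
    X.ope r s ((X.modes N).chiralGap a) b + X.ope r s a ((X.modes N).chiralGap b) +
      (2 * r : ℂ) • X.ope r s a b := by
  have h1 := hX.L_zero_ope r s a b
  have h2 := J_zero_ope hX hN r s a b
  simp only [N2Modes.chiralGap_apply, map_sub, map_smul, LinearMap.sub_apply, LinearMap.smul_apply]
  rw [h2, show (X.modes N).L 0 = X.L 0 from rfl, h1]
  module

theorem chiralGap_fermion {a : H} (ha : (X.modes N).chiralGap a = 0) :
    (X.modes N).chiralGap (X.fermion a) = 0 := by
  have h := congrArg X.fermion ha
  rw [map_zero, N2Modes.chiralGap_apply, modes_J_zero, map_sub, map_smul, hX.fermion_ope,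
    hN.parity.1, show (X.modes N).L 0 a = X.ope (-0 - 2) 0 X.T a from rfl, hX.fermion_ope,
    hX.fermion_T] at h
  rw [N2Modes.chiralGap_apply, modes_J_zero]
  exact h

omit hN in
theorem chiralGap_vac : (X.modes N).chiralGap X.vac = 0 := by
  have key : ∀ (r : ℝ) (a : H), r < 0 → X.ope r 0 a X.vac = 0 := by
    intro r a hr
    by_contra hne
    obtain ⟨m, n, hm, -⟩ := hX.ope_vac r 0 a hne
    have : (0 : ℝ) ≤ m := Nat.cast_nonneg m
    linarith
  rw [N2Modes.chiralGap_apply, modes_J_zero, show (X.modes N).L 0 X.vac =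
    X.ope (-0 - 2) 0 X.T X.vac from rfl, key _ _ (by norm_num), key _ _ (by norm_num)]
  simp

theorem chiralGap_mem {h k : ℝ} {v : H} (hv : v ∈ X.weightSpace h k) :
    (X.modes N).chiralGap v ∈ X.weightSpace h k := by
  refine sub_mem (Submodule.smul_mem _ _ ?_) ?_
  · rw [show (X.modes N).L 0 v = X.L 0 v from rfl, (mem_weightSpace.1 hv).1]
    exact Submodule.smul_mem _ _ hv
  · rw [modes_J_zero]
    have h1 := hX.ope_weight (-1) 0 _ _ _ _ _ _ hN.mem.1 hv
    rwa [show 1 + h + -1 = h by ring, show 0 + k + 0 = k by ring] at h1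

theorem chiralGap_ope_of_chiral {a b : H} (ha : (X.modes N).chiralGap a = 0)
    (hb : (X.modes N).chiralGap b = 0) (r s : ℝ) :
    (X.modes N).chiralGap (X.ope r s a b) = (2 * r : ℂ) • X.ope r s a b := by
  rw [chiralGap_ope hX hN, ha, hb]
  simp

theorem chiralGap_ope_zero {a b : H} (ha : (X.modes N).chiralGap a = 0)
    (hb : (X.modes N).chiralGap b = 0) (s : ℝ) : (X.modes N).chiralGap (X.ope 0 s a b) = 0 := by
  rw [chiralGap_ope_of_chiral hX hN ha hb]
  simp

variable (hU : X.IsUnitary) (hNU : (X.modes N).IsStar X.form)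
include hU hNU

theorem nonneg_of_ope_ne_zero {a b : H} (ha : (X.modes N).chiralGap a = 0)
    (hb : (X.modes N).chiralGap b = 0) {r s : ℝ} (hne : X.ope r s a b ≠ 0) : 0 ≤ r := by
  have h := N2Modes.chiralGap_eigenvalue_nonneg hN.algebra hNU hU.pos (t := 2 * r) hne
    (by rw [chiralGap_ope_of_chiral hX hN ha hb]; push_cast; rfl)
  linarith

omit hX in
theorem Gp_of_chiral {a : H} (ha : (X.modes N).chiralGap a = 0) :
    (X.modes N).Gp (-1 / 2) a = 0 :=
  (N2Modes.annihilated_of_chiralGap hN.algebra hNU hU.pos ha).1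

/-- The position dependent terms of the operator product of chiral states are exact:
`r b_{[r,s]} = (L₋₁ b)_{[r-1,s]}`, and `L₋₁ b` is `G⁺_{-1/2}`-exact. -/
theorem exists_ope_eq_Gp {b d : H} (hb : (X.modes N).chiralGap b = 0)
    (hd : (X.modes N).chiralGap d = 0) {r : ℝ} (hr : r ≠ 0) (s : ℝ) :
    ∃ y, X.ope r s b d = (X.modes N).Gp (-1 / 2) y := by
  have h1 := hX.translation (r - 1) s b d
  rw [sub_add_cancel, show X.L (-1) b = (X.modes N).L (-1) b from rfl,
    hN.algebra.L_neg_one_eq (Gp_of_chiral hN hU hNU hb)] at h1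
  set x := (1 / 2 : ℂ) • (X.modes N).Gm (-1 / 2) b
  have h2 := Gp_ope hX hN (r - 1) s x d
  rw [Gp_of_chiral hN hU hNU hd, map_zero, add_zero, h1] at h2
  refine ⟨(r : ℂ)⁻¹ • X.ope (r - 1) s x d, ?_⟩
  rw [map_smul, h2, smul_smul, inv_mul_cancel₀ (by exact_mod_cast hr), one_smul]

omit hX in
theorem form_Gp_eq_zero {v : H} (hv : (X.modes N).chiralGap v = 0) (y : H) :
    X.form v ((X.modes N).Gp (-1 / 2) y) = 0 := by
  have h1 := hNU.Gm_adj (1 / 2) v y N2Modes.isHalfOdd_half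
  rw [(N2Modes.annihilated_of_chiralGap hN.algebra hNU hU.pos hv).2, map_zero,
    LinearMap.zero_apply, show -(1 / 2 : ℝ) = -1 / 2 by norm_num] at h1
  exact h1.symm

/-- Matrix elements between chiral states see only the constant term of the operator product. -/
theorem form_ope_eq_zero {v a b : H} (hv : (X.modes N).chiralGap v = 0)
    (ha : (X.modes N).chiralGap a = 0) (hb : (X.modes N).chiralGap b = 0) {r s : ℝ}
    (hne : X.form v (X.ope r s a b) ≠ 0) : r = 0 := by
  by_contra hr
  obtain ⟨y, hy⟩ := exists_ope_eq_Gp hX hN hU hNU ha hb hr s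
  exact hne (by rw [hy, form_Gp_eq_zero hN hU hNU hv])

/-- Moving `G⁺_{-1/2}` to the left until it meets `v` removes every position dependent term of
`a (b d)`. -/
theorem exponents_eq_zero_of_ordered {v a b d : H} (hv : (X.modes N).chiralGap v = 0)
    (ha : (X.modes N).chiralGap a = 0) (hb : (X.modes N).chiralGap b = 0)
    (hd : (X.modes N).chiralGap d = 0) {r s r' s' : ℝ}
    (hne : X.form v (X.ope r s a (X.ope r' s' b d)) ≠ 0) : r = 0 ∧ r' = 0 := by
  have hr' : r' = 0 := by
    by_contra hr'
    obtain ⟨y, hy⟩ := exists_ope_eq_Gp hX hN hU hNU hb hd hr' s'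
    have h1 := Gp_ope hX hN r s (X.fermion a) y
    rw [Gp_of_chiral hN hU hNU (chiralGap_fermion hX hN ha), hX.fermion_sq, map_zero,
      LinearMap.zero_apply, zero_add] at h1
    exact hne (by rw [hy, ← h1, form_Gp_eq_zero hN hU hNU hv])
  subst hr'
  exact ⟨form_ope_eq_zero hX hN hU hNU hv ha (chiralGap_ope_zero hX hN hb hd s') hne, rfl⟩

theorem exponents_eq_zero_of_fused {v a b d : H} (hv : (X.modes N).chiralGap v = 0)
    (ha : (X.modes N).chiralGap a = 0) (hb : (X.modes N).chiralGap b = 0)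
    (hd : (X.modes N).chiralGap d = 0) {r s r' s' : ℝ}
    (hne : X.form v (X.ope r s (X.ope r' s' a b) d) ≠ 0) : r = 0 ∧ r' = 0 := by
  have hr' : r' = 0 := by
    by_contra hr'
    obtain ⟨y, hy⟩ := exists_ope_eq_Gp hX hN hU hNU ha hb hr' s'
    have h1 := Gp_ope hX hN r s y d
    rw [Gp_of_chiral hN hU hNU hd, map_zero, add_zero] at h1
    exact hne (by rw [hy, ← h1, form_Gp_eq_zero hN hU hNU hv])
  subst hr'
  exact ⟨form_ope_eq_zero hX hN hU hNU hv (chiralGap_ope_zero hX hN ha hb s') hd hne, rfl⟩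

omit hX in
/-- A weight vector in the kernel of `2 L₀ - J₀` is a chiral primary. -/
theorem isChiralPrimary_of_mem {h k : ℝ} {v : H} (hvW : v ∈ X.weightSpace h k)
    (hv : (X.modes N).chiralGap v = 0) : (X.modes N).IsChiralPrimary h (2 * h) v := by
  have hL : (X.modes N).L 0 v = (h : ℂ) • v := (mem_weightSpace.1 hvW).1
  refine N2Modes.isChiralPrimary_of_chiralGap hN.algebra hNU hU.pos hL ?_ hv
  rw [N2Modes.chiralGap_apply, sub_eq_zero, hL] at hv
  rw [← hv, smul_smul]
  push_cast
  rfl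

/-! ### The chiral rings -/

theorem chiralRing_eq :
    X.chiralRing N = LinearMap.ker (X.modes N).chiralGap ⊓ LinearMap.ker (X.Lbar 0) := by
  refine le_antisymm (Submodule.span_le.2 ?_) ?_
  · rintro v ⟨hhol, h, q, hv⟩
    exact ⟨hN.algebra.chiralGap_of_isChiralPrimary hv, (hX.isHolomorphic_iff hU).1 hhol⟩
  · rintro v ⟨hv, hv'⟩
    obtain ⟨f, hf, rfl⟩ := hX.exists_weight_decomposition v
    refine Submodule.sum_mem _ fun p _ => Submodule.subset_span ⟨?_, p.1, 2 * p.1, ?_⟩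
    · refine (hX.isHolomorphic_iff hU).2 ?_
      exact hX.apply_component_eq_zero hU hf (t := 0) (u := 0)
        (fun h k v hv => by simpa using hX.Lbar_mem hv 0) hv' p
    · refine isChiralPrimary_of_mem hN hU hNU (hf p) ?_
      exact hX.apply_component_eq_zero hU hf (t := 0) (u := 0)
        (fun h k v hv => by simpa using chiralGap_mem hX hN hv) hv p

theorem chiralChiralRing_eq (hN' : X.IsN2Bar N') (hNU' : (X.modesBar N').IsStar X.form) :
    X.chiralChiralRing N N' =
      LinearMap.ker (X.modes N).chiralGap ⊓ LinearMap.ker (X.modesBar N').chiralGap := by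
  refine le_antisymm (Submodule.span_le.2 ?_) ?_
  · rintro v ⟨⟨h, q, hv⟩, h', q', hv'⟩
    exact ⟨hN.algebra.chiralGap_of_isChiralPrimary hv,
      hN'.algebra.chiralGap_of_isChiralPrimary hv'⟩
  · rintro v ⟨hv, hv'⟩
    obtain ⟨f, hf, rfl⟩ := hX.exists_weight_decomposition v
    refine Submodule.sum_mem _ fun p _ =>
      Submodule.subset_span ⟨⟨p.1, 2 * p.1, ?_⟩, p.2, 2 * p.2, ?_⟩
    · refine isChiralPrimary_of_mem hN hU hNU (hf p) ?_
      exact hX.apply_component_eq_zero hU hf (t := 0) (u := 0)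
        (fun h k v hv => by simpa using chiralGap_mem hX hN hv) hv p
    · have hfp : f p ∈ X.mirror.weightSpace p.2 p.1 := by
        rw [mirror_weightSpace]
        exact hf p
      refine isChiralPrimary_of_mem hN'.mirror hU.mirror hNU' hfp ?_
      refine hX.apply_component_eq_zero hU hf (t := 0) (u := 0) (fun h k v hv => ?_) hv' p
      have hv : v ∈ X.mirror.weightSpace k h := by rwa [mirror_weightSpace]
      have h1 := chiralGap_mem hX.mirror hN'.mirror hv
      rw [mirror_weightSpace] at h1
      rw [add_zero, add_zero]
      exact h1

theorem isPointRing_chiralRing : X.IsPointRing (X.chiralRing N) := by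
  rw [chiralRing_eq hX hN hU hNU]
  have hol : ∀ {a : H}, a ∈ LinearMap.ker (X.Lbar 0) → X.IsHolomorphic a :=
    (hX.isHolomorphic_iff hU).2
  have hs : ∀ {a b : H} {r s : ℝ}, X.IsHolomorphic a → X.ope r s a b ≠ 0 → s = 0 := by
    intro a b r s ha hne
    by_contra h
    exact hne (by rw [ha r s h, LinearMap.zero_apply])
  have mulbar : ∀ {a b : H} (r : ℝ), a ∈ LinearMap.ker (X.Lbar 0) → b ∈ LinearMap.ker (X.Lbar 0) →
      X.ope r 0 a b ∈ LinearMap.ker (X.Lbar 0) := by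
    intro a b r ha hb
    rw [LinearMap.mem_ker] at *
    rw [hX.Lbar_zero_ope, ha, hb]
    simp
  refine hX.isPointRing_of_topological hU ⟨chiralGap_vac hX, ?_⟩ ?_ ?_ ?_ ?_ ?_
  · refine (hX.isHolomorphic_iff hU).1 fun r s h => LinearMap.ext fun b => ?_
    -- the unit operator does not depend on the position
    rw [hX.vac_ope, if_neg fun h' => h h'.2, LinearMap.zero_apply]
  · rintro a ⟨ha, ha'⟩
    refine ⟨chiralGap_fermion hX hN ha, ?_⟩
    have h := congrArg X.fermion ha'
    simp only [Lbar, modeBar, hX.fermion_ope, hX.fermion_Tbar, map_zero] at h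
    exact h
  · rintro a ⟨ha, ha'⟩ b ⟨hb, hb'⟩
    exact ⟨chiralGap_ope_zero hX hN ha hb 0, mulbar 0 ha' hb'⟩
  · rintro a ⟨ha, ha'⟩ b ⟨hb, hb'⟩ r s hne
    exact ⟨nonneg_of_ope_ne_zero hX hN hU hNU ha hb hne, (hs (hol ha') hne).ge⟩
  · rintro v ⟨hv, -⟩ a ⟨ha, ha'⟩ b ⟨hb, hb'⟩ d ⟨hd, hd'⟩ r s r' s' hne
    obtain ⟨h1, h2⟩ := exponents_eq_zero_of_ordered hX hN hU hNU hv ha hb hd hne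
    exact ⟨⟨h1, hs (hol ha') fun h => hne (by rw [h, map_zero])⟩, h2,
      hs (hol hb') fun h => hne (by rw [h, map_zero, map_zero])⟩
  · rintro v ⟨hv, -⟩ a ⟨ha, ha'⟩ b ⟨hb, hb'⟩ d ⟨hd, hd'⟩ r s r' s' hne
    obtain ⟨h1, h2⟩ := exponents_eq_zero_of_fused hX hN hU hNU hv ha hb hd hne
    have h3 : s' = 0 := hs (hol ha') fun h => hne (by rw [h]; simp)
    subst h3
    exact ⟨⟨h1, hs (hol (mulbar r' ha' hb')) fun h => hne (by rw [h, map_zero])⟩, h2, rfl⟩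

theorem isPointRing_chiralChiralRing (hN' : X.IsN2Bar N')
    (hNU' : (X.modesBar N').IsStar X.form) : X.IsPointRing (X.chiralChiralRing N N') := by
  rw [chiralChiralRing_eq hX hN hU hNU hN' hNU']
  have hX' := hX.mirror
  have hM := hN'.mirror
  have hU' := hU.mirror
  refine hX.isPointRing_of_topological hU ⟨chiralGap_vac hX, chiralGap_vac hX'⟩ ?_ ?_ ?_ ?_ ?_
  · rintro a ⟨ha, ha'⟩
    exact ⟨chiralGap_fermion hX hN ha, chiralGap_fermion hX' hM ha'⟩
  · rintro a ⟨ha, ha'⟩ b ⟨hb, hb'⟩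
    exact ⟨chiralGap_ope_zero hX hN ha hb 0, chiralGap_ope_zero hX' hM ha' hb' 0⟩
  · rintro a ⟨ha, ha'⟩ b ⟨hb, hb'⟩ r s hne
    exact ⟨nonneg_of_ope_ne_zero hX hN hU hNU ha hb hne,
      nonneg_of_ope_ne_zero hX' hM hU' hNU' ha' hb' (r := s) (s := r) hne⟩
  · rintro v ⟨hv, hv'⟩ a ⟨ha, ha'⟩ b ⟨hb, hb'⟩ d ⟨hd, hd'⟩ r s r' s' hne
    obtain ⟨h1, h2⟩ := exponents_eq_zero_of_ordered hX hN hU hNU hv ha hb hd hne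
    obtain ⟨h3, h4⟩ := exponents_eq_zero_of_ordered hX' hM hU' hNU' hv' ha' hb' hd'
      (r := s) (s := r) (r' := s') (s' := r') hne
    exact ⟨⟨h1, h3⟩, h2, h4⟩
  · rintro v ⟨hv, hv'⟩ a ⟨ha, ha'⟩ b ⟨hb, hb'⟩ d ⟨hd, hd'⟩ r s r' s' hne
    obtain ⟨h1, h2⟩ := exponents_eq_zero_of_fused hX hN hU hNU hv ha hb hd hne
    obtain ⟨h3, h4⟩ := exponents_eq_zero_of_fused hX' hM hU' hNU' hv' ha' hb' hd'
      (r := s) (s := r) (r' := s') (s' := r') hne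
    exact ⟨⟨h1, h3⟩, h2, h4⟩

theorem finiteDimensional_chiralRing (hnd : X.IsNondegenerate) :
    FiniteDimensional ℂ (X.chiralRing N) := by
  refine hnd.finiteDimensional_span (X.c / 6) ?_
  rintro v ⟨hhol, h, q, hv⟩ hv0
  obtain ⟨h1, h2⟩ := N2Modes.IsChiralPrimary.weight_bounds hN.algebra hNU hU.pos hv0 hv
  refine ⟨h, by rwa [abs_of_nonneg h1], ?_⟩
  have hL : X.L 0 v = (h : ℂ) • v := hv.1.weight
  rw [hamiltonian, LinearMap.add_apply, hL, (hX.isHolomorphic_iff hU).1 hhol, add_zero]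

omit hX in
theorem finiteDimensional_chiralChiralRing (hN' : X.IsN2Bar N')
    (hNU' : (X.modesBar N').IsStar X.form) (hnd : X.IsNondegenerate) :
    FiniteDimensional ℂ (X.chiralChiralRing N N') := by
  refine hnd.finiteDimensional_span (X.c / 6 + X.cbar / 6) ?_
  rintro v ⟨⟨h, q, hv⟩, h', q', hv'⟩ hv0
  obtain ⟨h1, h2⟩ := N2Modes.IsChiralPrimary.weight_bounds hN.algebra hNU hU.pos hv0 hv
  obtain ⟨h3, h4⟩ := N2Modes.IsChiralPrimary.weight_bounds hN'.algebra hNU' hU.pos hv0 hv'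
  refine ⟨h + h', by rw [abs_of_nonneg (add_nonneg h1 h3)]; exact add_le_add h2 h4, ?_⟩
  have hL : X.L 0 v = (h : ℂ) • v := hv.1.weight
  have hL' : X.Lbar 0 v = (h' : ℂ) • v := hv'.1.weight
  rw [hamiltonian, LinearMap.add_apply, hL, hL', ← add_smul]
  push_cast
  rfl

theorem isChiralPrimary_ope_zero {h₁ q₁ h₂ q₂ : ℝ} {a b : H}
    (ha : (X.modes N).IsChiralPrimary h₁ q₁ a) (hb : (X.modes N).IsChiralPrimary h₂ q₂ b) (s : ℝ) :
    (X.modes N).IsChiralPrimary (h₁ + h₂) (q₁ + q₂) (X.ope 0 s a b) := by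
  refine N2Modes.isChiralPrimary_of_chiralGap hN.algebra hNU hU.pos ?_ ?_
    (chiralGap_ope_zero hX hN (hN.algebra.chiralGap_of_isChiralPrimary ha)
      (hN.algebra.chiralGap_of_isChiralPrimary hb) s)
  · have h1 : X.L 0 a = (h₁ : ℂ) • a := ha.1.weight
    have h2 : X.L 0 b = (h₂ : ℂ) • b := hb.1.weight
    change X.L 0 _ = _
    rw [hX.L_zero_ope, h1, h2]
    simp only [map_smul, LinearMap.smul_apply]
    push_cast
    module
  · rw [J_zero_ope hX hN, ha.1.charge, hb.1.charge]
    simp only [map_smul, LinearMap.smul_apply]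
    push_cast
    module

end IsN2

end CFTData

theorem mainTheorem2 {H : Type*} [AddCommGroup H] [Module ℂ H] (X : CFTData H)
    (hX : X.IsCFT) (hU : X.IsUnitary)
    (N : N2Currents H) (hN : X.IsN2 N) (hNU : (X.modes N).IsStar X.form) :
    -- operator products of chiral primaries are non-singular in `z`, and the terms that survive
    -- in the limit `z → 0` are again chiral primaries
    (∀ (h₁ q₁ h₂ q₂ : ℝ) (a b : H), (X.modes N).IsChiralPrimary h₁ q₁ a →
      (X.modes N).IsChiralPrimary h₂ q₂ b →
        (∀ r s : ℝ, X.ope r s a b ≠ 0 → 0 ≤ r) ∧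
        ∀ s : ℝ, (X.modes N).IsChiralPrimary (h₁ + h₂) (q₁ + q₂) (X.ope 0 s a b)) ∧
    -- the weights of chiral primaries are bounded
    (∀ (h q : ℝ) (a : H), a ≠ 0 → (X.modes N).IsChiralPrimary h q a → 0 ≤ h ∧ h ≤ X.c / 6) ∧
    -- the chiral primaries form a ring, finite if the theory is non-degenerate
    X.IsPointRing (X.chiralRing N) ∧
    (X.IsNondegenerate → FiniteDimensional ℂ (X.chiralRing N)) ∧
    -- the same for operators depending on `z̄`, in a theory with `N = 2` in both sectors
    ∀ N' : N2Currents H, X.IsN2Bar N' → (X.modesBar N').IsStar X.form →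
      X.IsPointRing (X.chiralChiralRing N N') ∧
      (X.IsNondegenerate → FiniteDimensional ℂ (X.chiralChiralRing N N')) := by
  refine ⟨fun h₁ q₁ h₂ q₂ a b ha hb => ⟨fun r s hne => ?_, fun s => ?_⟩, fun h q a h0 ha => ?_,
    CFTData.IsN2.isPointRing_chiralRing hX hN hU hNU,
    CFTData.IsN2.finiteDimensional_chiralRing hX hN hU hNU, fun N' hN' hNU' => ⟨?_, ?_⟩⟩
  · exact CFTData.IsN2.nonneg_of_ope_ne_zero hX hN hU hNU
      (hN.algebra.chiralGap_of_isChiralPrimary ha) (hN.algebra.chiralGap_of_isChiralPrimary hb) hne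
  · exact CFTData.IsN2.isChiralPrimary_ope_zero hX hN hU hNU ha hb s
  · exact N2Modes.IsChiralPrimary.weight_bounds hN.algebra hNU hU.pos h0 ha
  · exact CFTData.IsN2.isPointRing_chiralChiralRing hX hN hU hNU hN' hNU'
  · exact CFTData.IsN2.finiteDimensional_chiralChiralRing hN hU hNU hN' hNU'
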